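/- **Setting.** Let $a,b\ge 1$, let $A\in\mathbb R^{a\times n}$ and $B\in\mathbb R^{b\times n}$ have full row rank, and let $\theta^1,\dots,\theta^U\in\mathbb R^n$ be the data vectors of $U$ users. Let $r=\operatorname{rank}\begin{bmatrix}A\\B\end{bmatrix}$, let $\begin{bmatrix}A\\B\end{bmatrix}=\mathcal U\Sigma\mathcal V^{T}$ be a compact singular value decomposition ($\mathcal U\in\mathbb R^{(a+b)\times r}$), and put $\phi^u=\Sigma\mathcal V^{T}\theta^u$, so that $\|\phi^u\|^2=\|A\theta^u\|^2+\|B\theta^u\|^2$. Let $\pi_A,\pi_B$ be the projections of $\mathbb R^{a+b}$ to the first $a$ and the last $b$ coordinates. For a matrix $X$ let $\sigma_k(X)$ be its $k$-th largest singular value; $\sigma_{\min}(\pi_A\mathcal U)$ means $\sigma_a(\pi_A\mathcal U)$ (the matrix is $a\times r$ with $a\le r$). **Exploration.** The users $1,\dots,U_0$ (with $U_0\le U$) form the beta group, and each of them pulls the same $N=H_0/U_0\in\mathbb N$ arms $x_1,\dots,x_N$, which are i.i.d. with law $\frac1{\sqrt b}\mathcal N(0,I_b)$. The observed rewards are $\langle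 x_i,B\theta^j\rangle+\eta_{ij}$ ($i\le N$, $j\le U_0$), where the $\eta_{ij}$ are independent, $1$-subgaussian ($\mathbb E e^{\lambda\eta_{ij}}\le e^{\lambda^2/2}$ for all $\lambda\in\mathbb R$), and independent of the arms. Let $D$ be the matrix with rows $x_1^T,\dots,x_N^T$ and let $\widehat{B\theta^j}=(D^TD)^{-1}D^TX_j$ be the least-squares estimate from the reward vector $X_j$ of user $j$. Put $$M=\begin{bmatrix}A\theta^1&\cdots&A\theta^{U_0}\\B\theta^1&\cdots&B\theta^{U_0}\end{bmatrix},\qquad \widehat M=\begin{bmatrix}A\theta^1&\cdots&A\theta^{U_0}\\\widehat{B\theta^1}&\cdots&\widehat{B\theta^{U_0}}\end{bmatrix},\qquad \sigma_{\min}(M):=\sigma_r(M).$$ Let $\widehat{\mathcal U}\in\mathbb R^{(a+b)\times r}$ consist of the first $r$ left singular vectors of a full singular value decomposition of $\widehat M$, with singular values in nonincreasing order. Put $$E_u=\operatorname{span}\{\pi_B\widehat{\mathcal U}(\pi_A\widehat{\mathcal U})^{+}A\theta^u\}+\pi_B\widehat{\mathcal U}\operatorname{Null}(\pi_A\widehat{\mathcal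 U})\subseteq\mathbb R^b ,$$ where $^+$ is the Moore–Penrose pseudo-inverse. For an orthogonal matrix $W=[W_\parallel\ W_\perp]$ such that the columns of $W_\parallel$ are a basis of $E_u$, let $L^u=\|W_\perp^{T}B\theta^u\|_2$. **Claim.** There is an absolute constant $C>0$ such that the following holds in every such setting and for every $\delta\in(0,1)$. Suppose $\sqrt{H_0/U_0}>C(\sqrt b+\sqrt{\log(4/\delta)})$ and put $$q=\frac{\sqrt{bU_0\,(b+\log(2/\delta))}}{\sqrt{H_0/U_0}-C\left(\sqrt b+\sqrt{\log(4/\delta)}\right)},\qquad Z=\frac{q}{\sigma_{\min}(M)-q}.$$ If $\sigma_{\min}(M)>q$ and $\sigma_{\min}(\pi_A\mathcal U)>\sqrt2\,Z$, then with probability at least $1-\delta$, simultaneously for all users $u\in\{1,\dots,U\}$ (and for all choices of $\widehat{\mathcal U}$ and $W$ as above), $$L^u\le\sqrt2\left(1+\left(\sigma_{\min}(\pi_A\mathcal U)-\sqrt2\,Z\right)^{-1}\right)Z\,\|\phi^u\|_2 .$$ In particular, $L^u\le\sqrt2\left(1+(\sigma_{\min}(\pi_A\mathcal U)-\sqrt2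 Z)^{-1}\right)Z$ for every user with $\|\phi^u\|_2\le1$. -/

import Mathlib

open MeasureTheory ProbabilityTheory Matrix
open scoped NNReal ENNReal

noncomputable section

namespace RecTransfer

/-- Euclidean norm of a coordinate vector. -/
def l2norm {m : ℕ} (v : Fin m → ℝ) : ℝ := ‖WithLp.toLp 2 v‖

/-- The `k`-th largest singular value `σ_k(X)`, with `k = 1, 2, …` (one-based; it is `0` as soon as
`k` exceeds the rank of `X`). -/
def sigma {m p : Type*} [Fintype m] [DecidableEq m] [Fintype p] [DecidableEq p]
    (X : Matrix m p ℝ) (k : ℕ) : ℝ :=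
  (Matrix.toEuclideanLin X).singularValues (k - 1)

/-- `X = 𝒰 Σ 𝒱ᵀ` is a compact singular value decomposition: `𝒰` and `𝒱` have orthonormal columns
and `Σ` is an `r × r` diagonal matrix with positive diagonal. (This forces `r = rank X`.) -/
structure IsCompactSVD {m p : Type*} [Fintype m] [Fintype p] {r : ℕ} (X : Matrix m p ℝ)
    (𝒰 : Matrix m (Fin r) ℝ) (s : Fin r → ℝ) (𝒱 : Matrix p (Fin r) ℝ) : Prop where
  left_orthonormal : 𝒰ᵀ * 𝒰 = 1
  right_orthonormal : 𝒱ᵀ * 𝒱 = 1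
  pos : ∀ k, 0 < s k
  eq : X = 𝒰 * Matrix.diagonal s * 𝒱ᵀ

/-- `𝒰hat` consists of the first `r` columns of the left orthogonal factor of some full singular
value decomposition `X = P S Qᵀ`, where `P`, `Q` are orthogonal and `S` is rectangular diagonal with
nonnegative nonincreasing diagonal. -/
def IsTopLeftSingular {a b p r : ℕ} (X : Matrix (Fin a ⊕ Fin b) (Fin p) ℝ)
    (𝒰hat : Matrix (Fin a ⊕ Fin b) (Fin r) ℝ) : Prop :=
  ∃ (hr : r ≤ a + b) (P : Matrix (Fin a ⊕ Fin b) (Fin (a + b)) ℝ) (Q : Matrix (Fin p) (Fin p) ℝ)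
    (s : ℕ → ℝ),
    Pᵀ * P = 1 ∧ P * Pᵀ = 1 ∧ Qᵀ * Q = 1 ∧ Q * Qᵀ = 1 ∧ Antitone s ∧ (∀ k, 0 ≤ s k) ∧
      X = P * (Matrix.of fun (i : Fin (a + b)) (j : Fin p) =>
        if (i : ℕ) = (j : ℕ) then s i else 0) * Qᵀ ∧
      𝒰hat = P.submatrix id (Fin.castLE hr)

/-- `Y` is the Moore–Penrose pseudo-inverse of the real matrix `X` (the four Penrose equations). -/
structure IsMoorePenrose {m p : Type*} [Fintype m] [Fintype p]
    (X : Matrix m p ℝ) (Y : Matrix p m ℝ) : Prop where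
  mul_mul_left : X * Y * X = X
  mul_mul_right : Y * X * Y = Y
  symm_left : (X * Y)ᵀ = X * Y
  symm_right : (Y * X)ᵀ = Y * X

/-- The stacked matrix `[A θ¹ ⋯ A θ^{U₀}; Y¹ ⋯ Y^{U₀}]`, with target columns `Y`. -/
def stacked {a b n U₀ : ℕ} (A : Matrix (Fin a) (Fin n) ℝ) (θ : Fin U₀ → Fin n → ℝ)
    (Y : Fin U₀ → Fin b → ℝ) : Matrix (Fin a ⊕ Fin b) (Fin U₀) ℝ :=
  Matrix.fromRows (Matrix.of fun i j => (A *ᵥ θ j) i) (Matrix.of fun i j => Y j i)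

/-- Ordinary least squares `(Dᵀ D)⁻¹ Dᵀ X`; the rows of `D` are the arms, `X` holds the rewards. -/
def leastSquares {N b : ℕ} (D : Matrix (Fin N) (Fin b) ℝ) (X : Fin N → ℝ) : Fin b → ℝ :=
  (Dᵀ * D)⁻¹ *ᵥ (Dᵀ *ᵥ X)

/-- Randomness of the exploration phase with `U₀` users and `N` pulls per user.
Row `i` of `D ω` is the `i`-th arm, the same for all users, and `η i j` is the noise in the `i`-th
reward of user `j`. The arms are i.i.d. `b^{-1/2} 𝒩(0, I_b)`, the noise variables are independent
and `1`-subgaussian (hence of mean `0`), and the arms do not depend on the noise. -/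
structure IsExploration {Ω : Type*} [MeasurableSpace Ω] (μ : Measure Ω) {N b U₀ : ℕ}
    (D : Ω → Matrix (Fin N) (Fin b) ℝ) (η : Fin N → Fin U₀ → Ω → ℝ) : Prop where
  arm_measurable : ∀ i k, Measurable fun ω => D ω i k
  arm_law : ∀ i k, μ.map (fun ω => D ω i k) = gaussianReal 0 (1 / (b : ℝ≥0))
  arm_indep : iIndepFun (fun (p : Fin N × Fin b) ω => D ω p.1 p.2) μ
  noise_measurable : ∀ i j, Measurable (η i j)
  noise_subgaussian : ∀ i j, HasSubgaussianMGF (η i j) 1 μ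
  noise_indep : iIndepFun (fun (p : Fin N × Fin U₀) ω => η p.1 p.2 ω) μ
  oblivious : IndepFun (fun ω (p : Fin N × Fin b) => D ω p.1 p.2)
    (fun ω (p : Fin N × Fin U₀) => η p.1 p.2 ω) μ

/-- The matrix estimated after exploration: the target columns are the per-user least-squares
estimates from the rewards `⟨xᵢ, B θʲ⟩ + ηᵢⱼ`. -/
def estimated {Ω : Type*} {a b n N U₀ : ℕ} (A : Matrix (Fin a) (Fin n) ℝ)
    (B : Matrix (Fin b) (Fin n) ℝ) (θ : Fin U₀ → Fin n → ℝ)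
    (D : Ω → Matrix (Fin N) (Fin b) ℝ) (η : Fin N → Fin U₀ → Ω → ℝ) (ω : Ω) :
    Matrix (Fin a ⊕ Fin b) (Fin U₀) ℝ :=
  stacked A θ fun j => leastSquares (D ω) fun i => D ω i ⬝ᵥ (B *ᵥ θ j) + η i j ω

/-- `E = span (D_T y, D_G)` for the source parameter `y`, where the transformer is
`D_T = π_B 𝒰hat (π_A 𝒰hat)⁺` (`pinv` stands for the pseudo-inverse) and the columns of the generator
`D_G` are a basis of `π_B 𝒰hat Null(π_A 𝒰hat)`. -/
def learnedSubspace {a b r : ℕ} (𝒰hat : Matrix (Fin a ⊕ Fin b) (Fin r) ℝ)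
    (pinv : Matrix (Fin r) (Fin a) ℝ) (y : Fin a → ℝ) : Submodule ℝ (Fin b → ℝ) :=
  Submodule.span ℝ {(𝒰hat.toRows₂ * pinv) *ᵥ y} ⊔
    (LinearMap.ker 𝒰hat.toRows₁.mulVecLin).map 𝒰hat.toRows₂.mulVecLin

/-- `W = [W_∥ W_⊥]` is an orthogonal matrix whose first `d` columns `W_∥` are a basis of `E`. -/
def IsAdaptedBasis {b : ℕ} (E : Submodule ℝ (Fin b → ℝ)) (d : ℕ) (W : Matrix (Fin b) (Fin b) ℝ) :
    Prop :=
  W ∈ Matrix.orthogonalGroup (Fin b) ℝ ∧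
    Submodule.span ℝ {v | ∃ k : Fin b, (k : ℕ) < d ∧ v = W.col k} = E

/-- The norm `‖W_⊥ᵀ x‖` of the coordinates of `Wᵀ x` beyond the first `d`. -/
def tailMass {b : ℕ} (d : ℕ) (W : Matrix (Fin b) (Fin b) ℝ) (x : Fin b → ℝ) : ℝ :=
  l2norm fun k : Fin b => if (k : ℕ) < d then 0 else (Wᵀ *ᵥ x) k

/-- The denominator `√(H₀/U₀) - C (√b + √(log (4/δ)))` of the noise level. -/
def noiseDenom (C : ℝ) (b U₀ H₀ : ℕ) (δ : ℝ) : ℝ :=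
  √((H₀ : ℝ) / U₀) - C * (√(b : ℝ) + √(Real.log (4 / δ)))

/-- The noise level `q`. -/
def noiseLevel (C : ℝ) (b U₀ H₀ : ℕ) (δ : ℝ) : ℝ :=
  √((b : ℝ) * U₀ * (b + Real.log (2 / δ))) / noiseDenom C b U₀ H₀ δ

end RecTransfer

end

/-! Write `c` for the denominator of `q` and `t = log (2/δ)`. The theorem combines two probabilistic
estimates with a deterministic perturbation bound.

Probability. An exponential-moment bound for chi-square variables and a union bound over a net of
the sphere give `√b ‖D u‖ ≥ c ‖u‖` for all `u`, outside probability `δ/2`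
(`exists_measure_arms_le`). For fixed arms, `D` times the least-squares error is the noise projected
onto the range of `D`. Gaussian linearization bounds its total square over all users by `8/5 b U₀ +
16/5 t`, outside probability `δ/2` (`measure_noise_le`), and independence transfers this to random
arms. Together these bound the Frobenius norm `f` of the error matrix by `f² ≤ b (8/5 b U₀ + 16/5 t)
/ c²`. This is at most `8/5 q²` when `U₀ ≥ 2`, and at most `16/5 q²` when `U₀ = 1`.

Perturbation. Let `σ` be the smallest singular value of `M`, and `V` the estimated singular vectors.
By Weyl, each `V c` has a preimage under the estimated matrix of norm at most `‖c‖ / (σ - f)`.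
Applying `M` to it lands in the range of `𝒰`, so the range of `V` is within `κ = f / (σ - f)` of
that of `𝒰`, and conversely because the dimensions agree. Hence the smallest singular value of `π_A
V` is at least that of `π_A 𝒰` minus `κ`. Project `𝒰 φ` onto the range of `V` and repair its source
part by the pseudo-inverse: this gives a point of the learned subspace near `B θ`
(`exists_mem_learnedSubspace_nrm_sub_le`).

The constant `√2`. One needs `κ ≤ √2 Z`. If the claimed factor is at least `1`, the claim follows
from `‖B θ‖ ≤ ‖φ‖`. Otherwise `σ` is a large multiple of `q`, and `8/5 < 2` leaves enough room
(`gap_le_of_nontrivial`). A single user, where `f` may exceed `√2 q`, forces `a = b = r = 1` and is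
settled by hand (`tailMass_le_of_one_user`). -/

noncomputable section

namespace RecTransfer


/-- Euclidean norm of a coordinate vector over any finite index type. -/
def nrm {ι : Type*} [Fintype ι] (v : ι → ℝ) : ℝ := ‖WithLp.toLp 2 v‖

/-! ### Euclidean norms, orthonormal columns and singular values -/

section EuclideanNorm

variable {ι κ : Type*} [Fintype ι] [Fintype κ]

theorem l2norm_eq_nrm {m : ℕ} (v : Fin m → ℝ) : l2norm v = nrm v := rfl

theorem nrm_nonneg (v : ι → ℝ) : 0 ≤ nrm v := norm_nonneg _

theorem nrm_sq (v : ι → ℝ) : nrm v ^ 2 = v ⬝ᵥ v := by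
  rw [nrm, EuclideanSpace.norm_sq_eq]
  simp [dotProduct, sq]

theorem nrm_sq_eq_sum (v : ι → ℝ) : nrm v ^ 2 = ∑ i, v i ^ 2 := by
  rw [nrm_sq]; simp [dotProduct, sq]

theorem dotProduct_eq_inner (v w : ι → ℝ) :
    v ⬝ᵥ w = inner ℝ (WithLp.toLp 2 v) (WithLp.toLp 2 w) := by
  simp [dotProduct, PiLp.inner_apply, mul_comm]

theorem dotProduct_le_nrm_mul_nrm (v w : ι → ℝ) : v ⬝ᵥ w ≤ nrm v * nrm w := by
  rw [dotProduct_eq_inner]; exact real_inner_le_norm _ _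

theorem nrm_add_le (v w : ι → ℝ) : nrm (v + w) ≤ nrm v + nrm w := by
  simpa [nrm, WithLp.toLp_add] using norm_add_le (WithLp.toLp 2 v) (WithLp.toLp 2 w)

theorem nrm_smul (c : ℝ) (v : ι → ℝ) : nrm (c • v) = |c| * nrm v := by
  simp [nrm, WithLp.toLp_smul, norm_smul]

@[simp] theorem nrm_zero : nrm (0 : ι → ℝ) = 0 := by simp [nrm]

theorem nrm_neg (v : ι → ℝ) : nrm (-v) = nrm v := by simp [nrm]

theorem nrm_sub_comm (v w : ι → ℝ) : nrm (v - w) = nrm (w - v) := by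
  rw [← nrm_neg, neg_sub]

theorem nrm_eq_zero {v : ι → ℝ} : nrm v = 0 ↔ v = 0 := by
  simp [nrm]

theorem nrm_pos {v : ι → ℝ} (h : v ≠ 0) : 0 < nrm v :=
  lt_of_le_of_ne (nrm_nonneg v) fun h0 => h (nrm_eq_zero.1 h0.symm)

theorem nrm_le_of_sq_le {v : ι → ℝ} {c : ℝ} (hc : 0 ≤ c) (h : nrm v ^ 2 ≤ c ^ 2) : nrm v ≤ c :=
  le_of_sq_le_sq h hc

theorem nrm_le_of_sq_le_mul {v : ι → ℝ} {c : ℝ} (hc : 0 ≤ c) (h : nrm v ^ 2 ≤ c * nrm v) :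
    nrm v ≤ c := by
  rcases (nrm_nonneg v).eq_or_lt with h0 | h0
  · rw [← h0]; exact hc
  · nlinarith

theorem mulVec_dotProduct (A : Matrix ι κ ℝ) (v : κ → ℝ) (w : ι → ℝ) :
    (A *ᵥ v) ⬝ᵥ w = v ⬝ᵥ (Aᵀ *ᵥ w) := by
  rw [Matrix.mulVec_transpose, dotProduct_comm v, ← Matrix.dotProduct_mulVec, dotProduct_comm]

theorem nrm_mulVec_of_transpose_mul_self [DecidableEq κ] {P : Matrix ι κ ℝ} (hP : Pᵀ * P = 1)
    (v : κ → ℝ) : nrm (P *ᵥ v) = nrm v := by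
  have : nrm (P *ᵥ v) ^ 2 = nrm v ^ 2 := by
    rw [nrm_sq, nrm_sq, mulVec_dotProduct, Matrix.mulVec_mulVec, hP, Matrix.one_mulVec]
  exact (sq_eq_sq₀ (nrm_nonneg _) (nrm_nonneg _)).1 this

theorem nrm_transpose_mulVec_le [DecidableEq κ] {P : Matrix ι κ ℝ} (hP : Pᵀ * P = 1)
    (y : ι → ℝ) : nrm (Pᵀ *ᵥ y) ≤ nrm y := by
  apply nrm_le_of_sq_le_mul (nrm_nonneg y)
  have h := dotProduct_le_nrm_mul_nrm (P *ᵥ (Pᵀ *ᵥ y)) y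
  rw [mulVec_dotProduct, nrm_mulVec_of_transpose_mul_self hP] at h
  rw [nrm_sq]; linarith

theorem nrm_mulVec_of_orthogonal [DecidableEq κ] [DecidableEq ι] {P : Matrix ι κ ℝ}
    (hP : P * Pᵀ = 1) (y : ι → ℝ) : nrm (Pᵀ *ᵥ y) = nrm y :=
  nrm_mulVec_of_transpose_mul_self (by rwa [Matrix.transpose_transpose]) y

theorem nrm_comp_inr_le (v : ι ⊕ κ → ℝ) : nrm (fun i => v (Sum.inr i)) ≤ nrm v := by
  apply nrm_le_of_sq_le (nrm_nonneg _)
  rw [nrm_sq_eq_sum, nrm_sq_eq_sum, Fintype.sum_sum_type]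
  have : 0 ≤ ∑ i, v (Sum.inl i) ^ 2 := by positivity
  linarith

theorem nrm_comp_inl_le (v : ι ⊕ κ → ℝ) : nrm (fun i => v (Sum.inl i)) ≤ nrm v := by
  apply nrm_le_of_sq_le (nrm_nonneg _)
  rw [nrm_sq_eq_sum, nrm_sq_eq_sum, Fintype.sum_sum_type]
  have : 0 ≤ ∑ i, v (Sum.inr i) ^ 2 := by positivity
  linarith

theorem nrm_elim_zero (v : ι → ℝ) : nrm (Sum.elim v (0 : κ → ℝ)) = nrm v := by
  apply (sq_eq_sq₀ (nrm_nonneg _) (nrm_nonneg _)).1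
  rw [nrm_sq_eq_sum, nrm_sq_eq_sum, Fintype.sum_sum_type]
  simp

theorem nrm_elim_zero_left (v : κ → ℝ) : nrm (Sum.elim (0 : ι → ℝ) v) = nrm v := by
  apply (sq_eq_sq₀ (nrm_nonneg _) (nrm_nonneg _)).1
  rw [nrm_sq_eq_sum, nrm_sq_eq_sum, Fintype.sum_sum_type]
  simp

/-- The orthogonal projection onto the range of a matrix with orthonormal columns is the best
approximation. -/
theorem nrm_sub_proj_le [DecidableEq κ] {P : Matrix ι κ ℝ} (hP : Pᵀ * P = 1) (y : ι → ℝ)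
    (c : κ → ℝ) : nrm (y - P *ᵥ (Pᵀ *ᵥ y)) ≤ nrm (y - P *ᵥ c) := by
  apply nrm_le_of_sq_le_mul (nrm_nonneg _)
  have h0 : Pᵀ *ᵥ (y - P *ᵥ (Pᵀ *ᵥ y)) = 0 := by
    rw [Matrix.mulVec_sub, Matrix.mulVec_mulVec, hP, Matrix.one_mulVec, sub_self]
  have h1 : nrm (y - P *ᵥ (Pᵀ *ᵥ y)) ^ 2 = (y - P *ᵥ c) ⬝ᵥ (y - P *ᵥ (Pᵀ *ᵥ y)) := by
    have : y - P *ᵥ (Pᵀ *ᵥ y) = (y - P *ᵥ c) + P *ᵥ (c - Pᵀ *ᵥ y) := by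
      rw [Matrix.mulVec_sub]; abel
    rw [nrm_sq]
    nth_rewrite 1 [this]
    rw [add_dotProduct, mulVec_dotProduct, h0, dotProduct_zero, add_zero]
  rw [h1]
  exact dotProduct_le_nrm_mul_nrm _ _

theorem nrm_sq_sub_proj [DecidableEq κ] {P : Matrix ι κ ℝ} (hP : Pᵀ * P = 1) (y : ι → ℝ) :
    nrm (y - P *ᵥ (Pᵀ *ᵥ y)) ^ 2 = nrm y ^ 2 - nrm (Pᵀ *ᵥ y) ^ 2 := by
  have h : (P *ᵥ (Pᵀ *ᵥ y)) ⬝ᵥ (P *ᵥ (Pᵀ *ᵥ y)) = nrm (Pᵀ *ᵥ y) ^ 2 := by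
    rw [← nrm_sq, nrm_mulVec_of_transpose_mul_self hP]
  have h' : (P *ᵥ (Pᵀ *ᵥ y)) ⬝ᵥ y = nrm (Pᵀ *ᵥ y) ^ 2 := by
    rw [mulVec_dotProduct, nrm_sq]
  rw [nrm_sq, sub_dotProduct, dotProduct_sub, dotProduct_sub, h,
    dotProduct_comm y (P *ᵥ (Pᵀ *ᵥ y)), h', nrm_sq y]
  ring

end EuclideanNorm

/-- The matrix whose columns are the first `k` right singular vectors. -/
theorem exists_orthonormal_sigma_mul_nrm_le {m : Type*} [Fintype m] [DecidableEq m] {p k : ℕ}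
    (X : Matrix m (Fin p) ℝ) (hk : 0 < k) (hpos : 0 < sigma X k) :
    ∃ L : Matrix (Fin p) (Fin k) ℝ, Lᵀ * L = 1 ∧
      ∀ c, sigma X k * nrm c ≤ nrm (X *ᵥ (L *ᵥ c)) := by
  classical
  set T := Matrix.toEuclideanLin X with hT
  have hn : Module.finrank ℝ (EuclideanSpace ℝ (Fin p)) = p := by simp
  have hkp : k ≤ p := by
    by_contra hlt
    have : T.singularValues (k - 1) = 0 := T.singularValues_of_finrank_le (by rw [hn]; omega)
    exact hpos.ne' this
  set hS := T.isSymmetric_adjoint_comp_self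
  set e := hS.eigenvectorBasis hn with he
  refine ⟨Matrix.of fun i j => e (Fin.castLE hkp j) i, ?_, fun c => ?_⟩
  · ext i j
    have := e.inner_eq_ite (Fin.castLE hkp i) (Fin.castLE hkp j)
    simp only [PiLp.inner_apply, RCLike.inner_apply, conj_trivial] at this
    simp only [Matrix.mul_apply, Matrix.transpose_apply, Matrix.of_apply, Matrix.one_apply]
    rw [← Finset.sum_congr rfl fun _ _ => mul_comm _ _, this]
    simp [Fin.ext_iff]
  · set L : Matrix (Fin p) (Fin k) ℝ := Matrix.of fun i j => e (Fin.castLE hkp j) i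
    have hv : WithLp.toLp 2 (L *ᵥ c) = ∑ j, c j • e (Fin.castLE hkp j) := by
      ext i
      simp [L, Matrix.mulVec, dotProduct, mul_comm]
    have hTv : WithLp.toLp 2 (X *ᵥ (L *ᵥ c)) = T (∑ j, c j • e (Fin.castLE hkp j)) := by
      rw [← hv]; rfl
    have hon : Orthonormal ℝ fun j : Fin k => e (Fin.castLE hkp j) :=
      e.orthonormal.comp _ (Fin.castLE_injective hkp)
    -- The columns of `L` are eigenvectors of the Gram operator of `X`, so no cross terms appear.
    have key : nrm (X *ᵥ (L *ᵥ c)) ^ 2 =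
        ∑ j, T.singularValues (j : Fin k) ^ 2 * c j ^ 2 := by
      rw [nrm, hTv, ← real_inner_self_eq_norm_sq, ← LinearMap.adjoint_inner_left]
      have : (LinearMap.adjoint T) (T (∑ j, c j • e (Fin.castLE hkp j))) =
          ∑ j : Fin k, (T.singularValues j ^ 2 * c j) • e (Fin.castLE hkp j) := by
        rw [map_sum, map_sum]
        refine Finset.sum_congr rfl fun j _ => ?_
        have h1 := hS.apply_eigenvectorBasis hn (Fin.castLE hkp j)
        rw [LinearMap.comp_apply] at h1
        rw [map_smul, map_smul, h1, ← T.sq_singularValues_fin hn (Fin.castLE hkp j), smul_smul]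
        simp [mul_comm, he]
      rw [this, hon.inner_sum]
      refine Finset.sum_congr rfl fun j _ => ?_
      simp; ring
    have hle : (sigma X k * nrm c) ^ 2 ≤ nrm (X *ᵥ (L *ᵥ c)) ^ 2 := by
      rw [key, mul_pow, nrm_sq_eq_sum, Finset.mul_sum]
      refine Finset.sum_le_sum fun j _ => mul_le_mul_of_nonneg_right ?_ (sq_nonneg _)
      exact pow_le_pow_left₀ (T.singularValues_nonneg _)
        (T.singularValues_antitone (by have := j.2; omega)) 2
    exact le_of_sq_le_sq hle (nrm_nonneg _)


/-! ### Perturbation of the top left singular subspace -/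

section Perturbation

variable {a b p r : ℕ}

theorem rectDiagonal_mulVec (s : ℕ → ℝ) {m p : ℕ} (w : Fin p → ℝ) (i : Fin m) :
    ((Matrix.of fun (i : Fin m) (j : Fin p) => if (i : ℕ) = (j : ℕ) then s i else 0) *ᵥ w) i =
      if h : (i : ℕ) < p then s i * w ⟨i, h⟩ else 0 := by
  simp only [Matrix.mulVec, dotProduct, Matrix.of_apply, ite_mul, zero_mul]
  split_ifs with h
  · rw [Finset.sum_eq_single ⟨i, h⟩]
    · simp
    · intro j _ hj
      rw [if_neg]
      intro hij; exact hj (Fin.ext hij.symm)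
    · simp
  · refine Finset.sum_eq_zero fun j _ => if_neg ?_
    have := j.2; omega

theorem nrm_rectDiagonal_mulVec_le {s : ℕ → ℝ} (hs : Antitone s) (hs0 : ∀ k, 0 ≤ s k) {m p : ℕ}
    (w : Fin p → ℝ) (k : ℕ) (hw : ∀ j : Fin p, (j : ℕ) < k → w j = 0) :
    nrm ((Matrix.of fun (i : Fin m) (j : Fin p) => if (i : ℕ) = (j : ℕ) then s i else 0) *ᵥ w) ≤
      s k * nrm w := by
  apply nrm_le_of_sq_le (mul_nonneg (hs0 k) (nrm_nonneg _))
  rw [mul_pow, nrm_sq_eq_sum, nrm_sq_eq_sum, Finset.mul_sum]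
  have h1 : ∀ i : Fin m, ((Matrix.of fun (i : Fin m) (j : Fin p) =>
      if (i : ℕ) = (j : ℕ) then s i else 0) *ᵥ w) i ^ 2 =
      ∑ j : Fin p, if (i : ℕ) = (j : ℕ) then s j ^ 2 * w j ^ 2 else 0 := by
    intro i
    rw [rectDiagonal_mulVec]
    split_ifs with h
    · rw [Finset.sum_eq_single ⟨i, h⟩]
      · simp [mul_pow]
      · intro j _ hj
        rw [if_neg]
        intro hij; exact hj (Fin.ext hij.symm)
      · simp
    · rw [Finset.sum_eq_zero fun j _ => if_neg ?_]
      · norm_num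
      · have := j.2; omega
  simp_rw [h1]
  rw [Finset.sum_comm]
  refine Finset.sum_le_sum fun j _ => ?_
  have h2 : s j ^ 2 * w j ^ 2 ≤ s k ^ 2 * w j ^ 2 := by
    by_cases hj : (j : ℕ) < k
    · simp [hw j hj]
    · exact mul_le_mul_of_nonneg_right
        (pow_le_pow_left₀ (hs0 _) (hs (not_lt.1 hj)) 2) (sq_nonneg _)
  by_cases hjm : (j : ℕ) < m
  · rw [Finset.sum_eq_single ⟨j, hjm⟩]
    · simpa using h2
    · intro i _ hi
      rw [if_neg]
      intro hij; exact hi (Fin.ext hij)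
    · simp
  · rw [Finset.sum_eq_zero fun i _ => if_neg ?_]
    · positivity
    · have := i.2; omega

theorem IsTopLeftSingular.transpose_mul_self {X : Matrix (Fin a ⊕ Fin b) (Fin p) ℝ}
    {V : Matrix (Fin a ⊕ Fin b) (Fin r) ℝ} (h : IsTopLeftSingular X V) : Vᵀ * V = 1 := by
  obtain ⟨hr, P, Q, s, hP, -, -, -, -, -, -, rfl⟩ := h
  have : (P.submatrix id (Fin.castLE hr))ᵀ * P.submatrix id (Fin.castLE hr) =
      (Pᵀ * P).submatrix (Fin.castLE hr) (Fin.castLE hr) := by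
    ext i j; simp [Matrix.mul_apply]
  rw [this, hP]
  ext i j
  simp [Matrix.one_apply, Fin.ext_iff]

/-- Weyl's inequality gives a preimage of controlled size of every vector in the span of the top
left singular vectors. -/
theorem IsTopLeftSingular.exists_preimage {X Y : Matrix (Fin a ⊕ Fin b) (Fin p) ℝ}
    {V : Matrix (Fin a ⊕ Fin b) (Fin r) ℝ} (h : IsTopLeftSingular Y V) (hr0 : 0 < r) {f : ℝ}
    (hf : ∀ w, nrm (Y *ᵥ w - X *ᵥ w) ≤ f * nrm w) (hf0 : 0 ≤ f) (hfX : f < sigma X r)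
    (c : Fin r → ℝ) : ∃ w, Y *ᵥ w = V *ᵥ c ∧ (sigma X r - f) * nrm w ≤ nrm c := by
  obtain ⟨hr, P, Q, s, hP, hP', hQ, hQ', hs, hs0, hY, rfl⟩ := h
  obtain ⟨L, hL, hLX⟩ := exists_orthonormal_sigma_mul_nrm_le X hr0 (hf0.trans_lt hfX)
  set S : Matrix (Fin (a + b)) (Fin p) ℝ :=
    Matrix.of fun i j => if (i : ℕ) = (j : ℕ) then s i else 0 with hS
  have hrp : r ≤ p := by
    have h1 := Matrix.rank_mul_le_right Lᵀ L
    rw [hL, Matrix.rank_one, Fintype.card_fin] at h1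
    simpa using h1.trans (Matrix.rank_le_card_height L)
  -- Weyl by counting dimensions: `r - 1` linear conditions on `r` coefficients leave a nonzero `c`
  -- with `L c` orthogonal to the first `r - 1` right singular vectors of `Y`. On `L c` the matrix
  -- `Y` stretches by at most `s (r - 1)`, and `X` by at least `sigma X r`. Since `s` is indexed
  -- from zero, `s (r - 1)` is the `r`-th singular value.
  have hweyl : sigma X r - f ≤ s (r - 1) := by
    let g : (Fin r → ℝ) →ₗ[ℝ] (Fin (r - 1) → ℝ) :=
      ((Qᵀ * L).submatrix (Fin.castLE (by omega : r - 1 ≤ p)) id).mulVecLin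
    obtain ⟨c, hc, hc0⟩ := (Submodule.ne_bot_iff _).1
      (LinearMap.ker_ne_bot_of_finrank_lt (f := g) (by simp; omega))
    have hker : ∀ j : Fin p, (j : ℕ) < r - 1 → (Qᵀ *ᵥ (L *ᵥ c)) j = 0 := by
      intro j hj
      have := congrFun (LinearMap.mem_ker.1 hc) ⟨j, hj⟩
      rw [Matrix.mulVec_mulVec]
      exact this
    have h1 : nrm (Y *ᵥ (L *ᵥ c)) ≤ s (r - 1) * nrm c := by
      rw [hY, ← Matrix.mulVec_mulVec, ← Matrix.mulVec_mulVec,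
        nrm_mulVec_of_transpose_mul_self hP]
      refine (nrm_rectDiagonal_mulVec_le hs hs0 _ (r - 1) hker).trans_eq ?_
      rw [nrm_mulVec_of_orthogonal hQ', nrm_mulVec_of_transpose_mul_self hL]
    have h2 := hf (L *ᵥ c)
    rw [nrm_mulVec_of_transpose_mul_self hL] at h2
    have h3 : nrm (X *ᵥ (L *ᵥ c)) ≤
        nrm (Y *ᵥ (L *ᵥ c)) + nrm (Y *ᵥ (L *ᵥ c) - X *ᵥ (L *ᵥ c)) := by
      rw [nrm_sub_comm (Y *ᵥ (L *ᵥ c))]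
      have := nrm_add_le (Y *ᵥ (L *ᵥ c)) (X *ᵥ (L *ᵥ c) - Y *ᵥ (L *ᵥ c))
      rwa [add_sub_cancel] at this
    have h4 := hLX c
    have hcpos := nrm_pos hc0
    by_contra hlt
    push Not at hlt
    nlinarith
  have hspos : 0 < s (r - 1) := by linarith
  have hsk : ∀ k : ℕ, k < r → s (r - 1) ≤ s k := fun k hk => hs (by omega)
  -- Invert `Y` on its top singular directions: divide the coordinates by the singular values, all
  -- at least `s (r - 1)`.
  refine ⟨Q *ᵥ fun j => if h : (j : ℕ) < r then c ⟨j, h⟩ / s j else 0, ?_, ?_⟩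
  · rw [hY, ← Matrix.mulVec_mulVec, ← Matrix.mulVec_mulVec, Matrix.mulVec_mulVec _ Qᵀ, hQ,
      Matrix.one_mulVec]
    have hpad : (S *ᵥ fun j : Fin p => if h : (j : ℕ) < r then c ⟨j, h⟩ / s j else 0) =
        fun i : Fin (a + b) => if h : (i : ℕ) < r then c ⟨i, h⟩ else 0 := by
      ext i
      rw [hS, rectDiagonal_mulVec]
      by_cases hi : (i : ℕ) < r
      · have := hspos.trans_le (hsk i hi)
        rw [dif_pos (hi.trans_le hrp), dif_pos hi, dif_pos hi]
        field_simp
      · simp [hi]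
    rw [hpad]
    ext i
    simp only [Matrix.mulVec, dotProduct, Matrix.submatrix_apply, id]
    symm
    refine Finset.sum_of_injOn (Fin.castLE hr) (Fin.castLE_injective hr).injOn (by simp) ?_ ?_
    · intro j _ hj
      rw [dif_neg, mul_zero]
      intro hjr
      exact hj ⟨⟨j, hjr⟩, by simp⟩
    · intro j _
      simp
  · rw [nrm_mulVec_of_transpose_mul_self hQ]
    refine (mul_le_mul_of_nonneg_right hweyl (nrm_nonneg _)).trans ?_
    apply le_of_sq_le_sq _ (nrm_nonneg _)
    rw [mul_pow, nrm_sq_eq_sum, nrm_sq_eq_sum, Finset.mul_sum]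
    have hsum : ∑ j : Fin r, s (r - 1) ^ 2 * (c j / s j) ^ 2 = ∑ j : Fin p,
        s (r - 1) ^ 2 * (if h : (j : ℕ) < r then c ⟨j, h⟩ / s j else 0) ^ 2 := by
      refine Finset.sum_of_injOn (Fin.castLE hrp) (Fin.castLE_injective hrp).injOn (by simp) ?_ ?_
      · intro j _ hj
        rw [dif_neg]
        · simp
        · intro hjr
          exact hj ⟨⟨j, hjr⟩, by simp⟩
      · intro j _
        simp
    rw [← hsum]
    refine Finset.sum_le_sum fun j _ => ?_
    have hj := hspos.trans_le (hsk j j.2)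
    have h1 : s (r - 1) ^ 2 ≤ s j ^ 2 := pow_le_pow_left₀ hspos.le (hsk j j.2) 2
    rw [div_pow, mul_div_assoc', div_le_iff₀ (by positivity), mul_comm]
    exact mul_le_mul_of_nonneg_left h1 (sq_nonneg _)

/-- For a preimage `w` of `V c` under `Y`, the vector `X w` lies in the range of `𝒰` and misses `V
c` by only `(Y - X) w`. The projection onto that range does at least as well. -/
theorem nrm_sub_proj_le_of_exists_preimage {m : Type*} [Fintype m]
    {X Y : Matrix m (Fin p) ℝ} {𝒰 V : Matrix m (Fin r) ℝ} (h𝒰 : 𝒰ᵀ * 𝒰 = 1)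
    {K : Matrix (Fin r) (Fin p) ℝ} (hX : X = 𝒰 * K) {f g : ℝ}
    (hf : ∀ w, nrm (Y *ᵥ w - X *ᵥ w) ≤ f * nrm w) (hf0 : 0 ≤ f) (hg : 0 < g) (c : Fin r → ℝ)
    (hw : ∃ w, Y *ᵥ w = V *ᵥ c ∧ g * nrm w ≤ nrm c) :
    nrm (V *ᵥ c - 𝒰 *ᵥ (𝒰ᵀ *ᵥ (V *ᵥ c))) ≤ f / g * nrm c := by
  obtain ⟨w, hw, hwc⟩ := hw
  have h1 := nrm_sub_proj_le h𝒰 (V *ᵥ c) (K *ᵥ w)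
  rw [Matrix.mulVec_mulVec w 𝒰 K, ← hX] at h1
  have h2 := hf w
  rw [hw] at h2
  refine (h1.trans h2).trans ?_
  rw [div_mul_eq_mul_div, le_div_iff₀ hg, mul_assoc]
  exact mul_le_mul_of_nonneg_left (by linarith) hf0

/-- A lower bound for a square matrix passes to its transpose. -/
theorem le_nrm_transpose_mulVec (K : Matrix (Fin r) (Fin r) ℝ) {γ : ℝ} (hγ : 0 < γ)
    (h : ∀ c, γ * nrm c ≤ nrm (K *ᵥ c)) (x : Fin r → ℝ) : γ * nrm x ≤ nrm (Kᵀ *ᵥ x) := by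
  have hinj : Function.Injective K.mulVecLin := by
    rw [← LinearMap.ker_eq_bot, LinearMap.ker_eq_bot']
    intro c hc
    have h1 := h c
    rw [show K *ᵥ c = 0 from hc, nrm_zero] at h1
    have h2 := nrm_nonneg c
    exact nrm_eq_zero.1 (le_antisymm (by by_contra h3; push Not at h3; nlinarith) h2)
  obtain ⟨c, rfl⟩ := (LinearMap.injective_iff_surjective.1 hinj) x
  have h1 := h c
  have h2 : nrm (K *ᵥ c) ^ 2 ≤ nrm c * nrm (Kᵀ *ᵥ (K *ᵥ c)) := by
    rw [nrm_sq, mulVec_dotProduct]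
    exact dotProduct_le_nrm_mul_nrm _ _
  change γ * nrm (K *ᵥ c) ≤ nrm (Kᵀ *ᵥ (K *ᵥ c))
  rcases (nrm_nonneg (K *ᵥ c)).eq_or_lt with h0 | h0
  · rw [← h0, mul_zero]; exact nrm_nonneg _
  · have h3 : γ * nrm c * nrm (Kᵀ *ᵥ (K *ᵥ c)) ≤ nrm (K *ᵥ c) * nrm (Kᵀ *ᵥ (K *ᵥ c)) :=
      mul_le_mul_of_nonneg_right h1 (nrm_nonneg _)
    have h4 : nrm (K *ᵥ c) * (γ * nrm (K *ᵥ c)) ≤ nrm (K *ᵥ c) * nrm (Kᵀ *ᵥ (K *ᵥ c)) := by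
      nlinarith
    exact le_of_mul_le_mul_left h4 h0

/-- Two subspaces of the same dimension have the same gap in both directions. -/
theorem nrm_sub_proj_le_symm {m : Type*} [Fintype m] {𝒰 V : Matrix m (Fin r) ℝ}
    (h𝒰 : 𝒰ᵀ * 𝒰 = 1) (hV : Vᵀ * V = 1) {κ : ℝ} (hκ0 : 0 ≤ κ) (hκ : κ < 1)
    (h : ∀ c, nrm (V *ᵥ c - 𝒰 *ᵥ (𝒰ᵀ *ᵥ (V *ᵥ c))) ≤ κ * nrm c) (x : Fin r → ℝ) :
    nrm (𝒰 *ᵥ x - V *ᵥ (Vᵀ *ᵥ (𝒰 *ᵥ x))) ≤ κ * nrm x := by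
  have hpos : 0 < 1 - κ ^ 2 := by nlinarith
  have hγ := Real.sqrt_pos.2 hpos
  -- By Pythagoras a gap of at most `κ` means that `𝒰ᵀ V` is bounded below by `√(1 - κ²)`. The
  -- matrix is square, so its transpose `Vᵀ 𝒰` has the same lower bound.
  have key := le_nrm_transpose_mulVec (𝒰ᵀ * V) hγ (fun c => by
    apply le_of_sq_le_sq _ (nrm_nonneg _)
    have h1 := nrm_sq_sub_proj h𝒰 (V *ᵥ c)
    have h2 := pow_le_pow_left₀ (nrm_nonneg _) (h c) 2
    rw [nrm_mulVec_of_transpose_mul_self hV] at h1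
    rw [mul_pow, Real.sq_sqrt hpos.le, ← Matrix.mulVec_mulVec]
    nlinarith) x
  rw [Matrix.transpose_mul, Matrix.transpose_transpose, ← Matrix.mulVec_mulVec] at key
  apply nrm_le_of_sq_le (mul_nonneg hκ0 (nrm_nonneg _))
  have h2 := pow_le_pow_left₀ (mul_nonneg hγ.le (nrm_nonneg _)) key 2
  rw [mul_pow, Real.sq_sqrt hpos.le] at h2
  rw [nrm_sq_sub_proj hV, nrm_mulVec_of_transpose_mul_self h𝒰, mul_pow]
  nlinarith

/-- Split `y` along the range of `V` and its complement. The complementary part enters through `𝒰ᵀ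
(1 - V Vᵀ)`, the adjoint of the operator bounded in `h`. With `y` supported on the source
coordinates this compares the smallest singular values of `π_A 𝒰` and `π_A V`. -/
theorem nrm_transpose_mulVec_le_add {m : Type*} [Fintype m] {𝒰 V : Matrix m (Fin r) ℝ}
    (h𝒰 : 𝒰ᵀ * 𝒰 = 1) (hV : Vᵀ * V = 1) {κ : ℝ} (hκ0 : 0 ≤ κ)
    (h : ∀ x, nrm (𝒰 *ᵥ x - V *ᵥ (Vᵀ *ᵥ (𝒰 *ᵥ x))) ≤ κ * nrm x) (y : m → ℝ) :
    nrm (𝒰ᵀ *ᵥ y) ≤ nrm (Vᵀ *ᵥ y) + κ * nrm y := by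
  set w := 𝒰ᵀ *ᵥ (y - V *ᵥ (Vᵀ *ᵥ y)) with hw
  have h1 : 𝒰ᵀ *ᵥ y = 𝒰ᵀ *ᵥ (V *ᵥ (Vᵀ *ᵥ y)) + w := by
    rw [hw, ← Matrix.mulVec_add, add_sub_cancel]
  have h2 : nrm (𝒰ᵀ *ᵥ (V *ᵥ (Vᵀ *ᵥ y))) ≤ nrm (Vᵀ *ᵥ y) := by
    refine (nrm_transpose_mulVec_le h𝒰 _).trans_eq ?_
    rw [nrm_mulVec_of_transpose_mul_self hV]
  have h3 : nrm w ≤ κ * nrm y := by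
    apply nrm_le_of_sq_le_mul (mul_nonneg hκ0 (nrm_nonneg _))
    have e1 : nrm w ^ 2 = (𝒰 *ᵥ w - V *ᵥ (Vᵀ *ᵥ (𝒰 *ᵥ w))) ⬝ᵥ y := by
      rw [nrm_sq]
      nth_rewrite 2 [hw]
      rw [← mulVec_dotProduct, dotProduct_sub, sub_dotProduct, mulVec_dotProduct V,
        dotProduct_comm (𝒰 *ᵥ w) (V *ᵥ _), mulVec_dotProduct V, dotProduct_comm (Vᵀ *ᵥ y)]
    rw [e1]
    refine (dotProduct_le_nrm_mul_nrm _ _).trans ?_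
    nlinarith [mul_le_mul_of_nonneg_right (h w) (nrm_nonneg y)]
  rw [h1]
  exact (nrm_add_le _ _).trans (add_le_add h2 h3)

end Perturbation

/-! ### Pseudo-inverse and distance to the learned subspace -/

section LearnedSubspace

variable {a b r : ℕ}

/-- The Penrose equations place the residual in the kernel of `Xᵀ`, which is trivial by `hX`. -/
theorem IsMoorePenrose.mulVec_mulVec_cancel {X : Matrix (Fin a) (Fin r) ℝ} {Y : Matrix (Fin r) (Fin a) ℝ}
    (h : IsMoorePenrose X Y) {γ : ℝ} (hγ : 0 < γ) (hX : ∀ y, γ * nrm y ≤ nrm (Xᵀ *ᵥ y))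
    (y : Fin a → ℝ) : X *ᵥ (Y *ᵥ y) = y := by
  have h0 : Xᵀ *ᵥ (X *ᵥ (Y *ᵥ y) - y) = 0 := by
    have : Xᵀ * (X * Y) = Xᵀ := by
      rw [← h.symm_left, ← Matrix.transpose_mul, h.mul_mul_left]
    rw [Matrix.mulVec_sub, Matrix.mulVec_mulVec _ X, Matrix.mulVec_mulVec, this, sub_self]
  have h1 := hX (X *ᵥ (Y *ᵥ y) - y)
  rw [h0, nrm_zero] at h1
  have h2 := nrm_nonneg (X *ᵥ (Y *ᵥ y) - y)
  have h3 : nrm (X *ᵥ (Y *ᵥ y) - y) = 0 :=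
    le_antisymm (by by_contra h3; push Not at h3; nlinarith) h2
  exact sub_eq_zero.1 (nrm_eq_zero.1 h3)

/-- The solution `Y y` lies in the row space: `Y y = Xᵀ v`. Then `‖Y y‖² = ⟨v, X Y y⟩ = ⟨v, y⟩`,
while `hX` bounds `‖v‖` by `‖Y y‖ / γ`. -/
theorem IsMoorePenrose.mul_nrm_mulVec_le {X : Matrix (Fin a) (Fin r) ℝ}
    {Y : Matrix (Fin r) (Fin a) ℝ} (h : IsMoorePenrose X Y) {γ : ℝ} (hγ : 0 < γ)
    (hX : ∀ y, γ * nrm y ≤ nrm (Xᵀ *ᵥ y)) (y : Fin a → ℝ) : γ * nrm (Y *ᵥ y) ≤ nrm y := by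
  set v := Yᵀ *ᵥ (Y *ᵥ y) with hv
  have hz : Y *ᵥ y = Xᵀ *ᵥ v := by
    rw [hv, Matrix.mulVec_mulVec, ← Matrix.transpose_mul, h.symm_right, Matrix.mulVec_mulVec,
      h.mul_mul_right]
  have h1 : nrm (Y *ᵥ y) ^ 2 ≤ nrm v * nrm y := by
    rw [nrm_sq]
    nth_rewrite 1 [hz]
    rw [mulVec_dotProduct, Matrix.transpose_transpose, h.mulVec_mulVec_cancel hγ hX]
    exact dotProduct_le_nrm_mul_nrm _ _
  have h2 := hX v
  rw [← hz] at h2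
  rcases (nrm_nonneg (Y *ᵥ y)).eq_or_lt with h0 | h0
  · rw [← h0, mul_zero]; exact nrm_nonneg _
  · have h3 := mul_le_mul_of_nonneg_right h2 (nrm_nonneg y)
    have h4 : nrm (Y *ᵥ y) * (γ * nrm (Y *ᵥ y)) ≤ nrm (Y *ᵥ y) * nrm y := by nlinarith
    exact le_of_mul_le_mul_left h4 h0

/-- Two representations with the same source part differ by an element of `Null(π_A V)`, so the
learned subspace contains every target vector compatible with `y`. -/
theorem mulVec_mem_learnedSubspace (V : Matrix (Fin a ⊕ Fin b) (Fin r) ℝ)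
    (Y : Matrix (Fin r) (Fin a) ℝ) {y : Fin a → ℝ} (hy : V.toRows₁ *ᵥ (Y *ᵥ y) = y)
    {x : Fin r → ℝ} (hx : V.toRows₁ *ᵥ x = y) : V.toRows₂ *ᵥ x ∈ learnedSubspace V Y y := by
  have : V.toRows₂ *ᵥ x = (V.toRows₂ * Y) *ᵥ y + V.toRows₂ *ᵥ (x - Y *ᵥ y) := by
    rw [← Matrix.mulVec_mulVec, ← Matrix.mulVec_add, add_sub_cancel]
  rw [this]
  refine Submodule.add_mem_sup (Submodule.mem_span_singleton_self _) ⟨x - Y *ᵥ y, ?_, rfl⟩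
  change V.toRows₁ *ᵥ (x - Y *ᵥ y) = 0
  rw [Matrix.mulVec_sub, hy, hx, sub_self]

theorem toRows₁_mulVec {κ : Type*} [Fintype κ] (V : Matrix (Fin a ⊕ Fin b) κ ℝ) (x : κ → ℝ) :
    V.toRows₁ *ᵥ x = fun i => (V *ᵥ x) (Sum.inl i) := rfl

theorem toRows₂_mulVec {κ : Type*} [Fintype κ] (V : Matrix (Fin a ⊕ Fin b) κ ℝ) (x : κ → ℝ) :
    V.toRows₂ *ᵥ x = fun i => (V *ᵥ x) (Sum.inr i) := rfl

theorem toRows₁_transpose_mulVec (V : Matrix (Fin a ⊕ Fin b) (Fin r) ℝ) (y : Fin a → ℝ) :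
    V.toRows₁ᵀ *ᵥ y = Vᵀ *ᵥ Sum.elim y 0 := by
  ext i
  simp [Matrix.mulVec, dotProduct, Matrix.toRows₁]

/-- A vector of the form `π_B 𝒰 x` is close to the subspace learned from `π_A 𝒰 x`. -/
theorem exists_mem_learnedSubspace_nrm_sub_le {𝒰 V : Matrix (Fin a ⊕ Fin b) (Fin r) ℝ}
    (hV : Vᵀ * V = 1) {κ γ : ℝ} (hγ : 0 < γ)
    (h : ∀ x, nrm (𝒰 *ᵥ x - V *ᵥ (Vᵀ *ᵥ (𝒰 *ᵥ x))) ≤ κ * nrm x)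
    (hX : ∀ y, γ * nrm y ≤ nrm (V.toRows₁ᵀ *ᵥ y)) {Y : Matrix (Fin r) (Fin a) ℝ}
    (hY : IsMoorePenrose V.toRows₁ Y) (x : Fin r → ℝ) :
    ∃ e ∈ learnedSubspace V Y (𝒰.toRows₁ *ᵥ x),
      nrm (𝒰.toRows₂ *ᵥ x - e) ≤ κ * (1 + γ⁻¹) * nrm x := by
  set z := Vᵀ *ᵥ (𝒰 *ᵥ x) with hz
  set d := 𝒰.toRows₁ *ᵥ x - V.toRows₁ *ᵥ z with hd
  have hright := hY.mulVec_mulVec_cancel hγ hX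
  -- The projected coordinates `z` miss the prescribed source vector by `d`. Adding `Y d` makes the
  -- source part exact, at a cost of at most `γ⁻¹ ‖d‖`.
  refine ⟨V.toRows₂ *ᵥ (z + Y *ᵥ d), mulVec_mem_learnedSubspace V Y (hright _) ?_, ?_⟩
  · rw [Matrix.mulVec_add, hright, hd, add_sub_cancel]
  have h1 : nrm d ≤ κ * nrm x := (nrm_comp_inl_le (𝒰 *ᵥ x - V *ᵥ z)).trans (h x)
  have h2 : nrm (𝒰.toRows₂ *ᵥ x - V.toRows₂ *ᵥ z) ≤ κ * nrm x :=
    (nrm_comp_inr_le (𝒰 *ᵥ x - V *ᵥ z)).trans (h x)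
  have h3 : nrm (V.toRows₂ *ᵥ (Y *ᵥ d)) ≤ nrm (Y *ᵥ d) :=
    (nrm_comp_inr_le (V *ᵥ (Y *ᵥ d))).trans_eq (nrm_mulVec_of_transpose_mul_self hV _)
  have h4 := hY.mul_nrm_mulVec_le hγ hX d
  have h5 : nrm (Y *ᵥ d) ≤ γ⁻¹ * (κ * nrm x) := by
    rw [inv_mul_eq_div, le_div_iff₀ hγ, mul_comm]; exact h4.trans h1
  have h6 : 𝒰.toRows₂ *ᵥ x - V.toRows₂ *ᵥ (z + Y *ᵥ d) =
      (𝒰.toRows₂ *ᵥ x - V.toRows₂ *ᵥ z) + -(V.toRows₂ *ᵥ (Y *ᵥ d)) := by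
    rw [Matrix.mulVec_add]; abel
  rw [h6]
  refine (nrm_add_le _ _).trans ?_
  rw [nrm_neg]
  linarith

theorem tailMass_le_nrm {W : Matrix (Fin b) (Fin b) ℝ} (hW : W ∈ Matrix.orthogonalGroup (Fin b) ℝ)
    (d : ℕ) (x : Fin b → ℝ) : tailMass d W x ≤ nrm x := by
  have hW' : W * Wᵀ = 1 := (Matrix.mem_orthogonalGroup_iff (Fin b) ℝ).1 hW
  rw [tailMass, l2norm_eq_nrm, ← nrm_mulVec_of_orthogonal hW' x]
  apply nrm_le_of_sq_le (nrm_nonneg _)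
  rw [nrm_sq_eq_sum, nrm_sq_eq_sum]
  refine Finset.sum_le_sum fun k _ => ?_
  split_ifs
  · simpa using sq_nonneg _
  · exact le_rfl

theorem IsAdaptedBasis.tailMass_le {E : Submodule ℝ (Fin b → ℝ)} {d : ℕ}
    {W : Matrix (Fin b) (Fin b) ℝ} (h : IsAdaptedBasis E d W) (x : Fin b → ℝ) {e : Fin b → ℝ}
    (he : e ∈ E) : tailMass d W x ≤ nrm (x - e) := by
  have hW' : Wᵀ * W = 1 := (Matrix.mem_orthogonalGroup_iff' (Fin b) ℝ).1 h.1
  have hz : ∀ k : Fin b, ¬ (k : ℕ) < d → (Wᵀ *ᵥ e) k = 0 := by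
    intro k hk
    rw [← h.2] at he
    induction he using Submodule.span_induction with
    | mem v hv =>
      obtain ⟨j, hj, rfl⟩ := hv
      have : (Wᵀ *ᵥ W.col j) k = (Wᵀ * W) k j := rfl
      rw [this, hW', Matrix.one_apply_ne]
      rintro rfl; exact hk hj
    | zero => simp
    | add v w _ _ hv hw => rw [Matrix.mulVec_add, Pi.add_apply, hv, hw, add_zero]
    | smul c v _ hv => rw [Matrix.mulVec_smul, Pi.smul_apply, hv, smul_zero]
  have : tailMass d W x = tailMass d W (x - e) := by
    unfold tailMass
    congr 1
    ext k
    split_ifs with hk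
    · rfl
    · rw [Matrix.mulVec_sub, Pi.sub_apply, hz k hk, sub_zero]
  rw [this]
  exact tailMass_le_nrm h.1 d _

end LearnedSubspace


/-! ### Deterministic bounds: small error, and the one-user case -/

section Deterministic

variable {a b n r p : ℕ}

theorem le_card_of_sigma_pos {m : Type*} [Fintype m] [DecidableEq m] {X : Matrix m (Fin p) ℝ}
    {k : ℕ} (hk : 0 < k) (h : 0 < sigma X k) : k ≤ p := by
  have h1 := (LinearMap.singularValues_pos_iff_lt_finrank_range _).1 h
  have h2 := (LinearMap.finrank_range_le (Matrix.toEuclideanLin X))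
  simp only [finrank_euclideanSpace, Fintype.card_fin] at h2
  omega

/-- Restricting to the top `a` right singular vectors gives the square matrix `X L`, whose lower
bound passes to the transpose. Removing the contraction `Lᵀ` only increases the norm. -/
theorem sigma_mul_nrm_le_transpose {X : Matrix (Fin a) (Fin r) ℝ} (ha : 0 < a)
    (h : 0 < sigma X a) (y : Fin a → ℝ) : sigma X a * nrm y ≤ nrm (Xᵀ *ᵥ y) := by
  obtain ⟨L, hL, hLX⟩ := exists_orthonormal_sigma_mul_nrm_le X ha h
  have h1 := le_nrm_transpose_mulVec (X * L) h
    (fun c => by rw [← Matrix.mulVec_mulVec]; exact hLX c) y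
  rw [Matrix.transpose_mul, ← Matrix.mulVec_mulVec] at h1
  exact h1.trans (nrm_transpose_mulVec_le hL _)

/-- Test on a unit vector; `𝒰ᵀ` is a contraction. The bound makes the inverse in the final estimate
at least `1`. -/
theorem sigma_toRows₁_le_one {𝒰 : Matrix (Fin a ⊕ Fin b) (Fin r) ℝ} (h𝒰 : 𝒰ᵀ * 𝒰 = 1)
    (ha : 0 < a) (h : 0 < sigma 𝒰.toRows₁ a) : sigma 𝒰.toRows₁ a ≤ 1 := by
  have h1 := sigma_mul_nrm_le_transpose ha h (Pi.single ⟨0, ha⟩ 1)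
  rw [toRows₁_transpose_mulVec] at h1
  have h2 := nrm_transpose_mulVec_le h𝒰 (Sum.elim (Pi.single (⟨0, ha⟩ : Fin a) (1 : ℝ)) 0)
  have h3 : nrm (Pi.single (⟨0, ha⟩ : Fin a) (1 : ℝ)) = 1 := by simp [nrm]
  rw [nrm_elim_zero, h3] at h2
  rw [h3] at h1
  linarith

section SVD

variable {A : Matrix (Fin a) (Fin n) ℝ} {B : Matrix (Fin b) (Fin n) ℝ}
  {𝒰 : Matrix (Fin a ⊕ Fin b) (Fin r) ℝ} {s : Fin r → ℝ} {𝒱 : Matrix (Fin n) (Fin r) ℝ}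

theorem IsCompactSVD.mulVec_eq (h : IsCompactSVD (Matrix.fromRows A B) 𝒰 s 𝒱) (θ : Fin n → ℝ) :
    Matrix.fromRows A B *ᵥ θ = 𝒰 *ᵥ (Matrix.diagonal s *ᵥ (𝒱ᵀ *ᵥ θ)) := by
  rw [h.eq]; simp only [Matrix.mulVec_mulVec, Matrix.mul_assoc]

theorem IsCompactSVD.mulVec_fst (h : IsCompactSVD (Matrix.fromRows A B) 𝒰 s 𝒱)
    (θ : Fin n → ℝ) : A *ᵥ θ = 𝒰.toRows₁ *ᵥ (Matrix.diagonal s *ᵥ (𝒱ᵀ *ᵥ θ)) := by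
  rw [toRows₁_mulVec, ← h.mulVec_eq]; rfl

theorem IsCompactSVD.mulVec_snd (h : IsCompactSVD (Matrix.fromRows A B) 𝒰 s 𝒱)
    (θ : Fin n → ℝ) : B *ᵥ θ = 𝒰.toRows₂ *ᵥ (Matrix.diagonal s *ᵥ (𝒱ᵀ *ᵥ θ)) := by
  rw [toRows₂_mulVec, ← h.mulVec_eq]; rfl

theorem IsCompactSVD.stacked_eq (h : IsCompactSVD (Matrix.fromRows A B) 𝒰 s 𝒱)
    (θ : Fin p → Fin n → ℝ) : stacked A θ (fun j => B *ᵥ θ j) =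
      𝒰 * Matrix.of fun k j => (Matrix.diagonal s *ᵥ (𝒱ᵀ *ᵥ θ j)) k := by
  ext i j
  have : stacked A θ (fun j => B *ᵥ θ j) i j = (Matrix.fromRows A B *ᵥ θ j) i := by
    cases i <;> rfl
  rw [this, h.mulVec_eq]; rfl

theorem IsCompactSVD.nrm_mulVec_snd_le (h : IsCompactSVD (Matrix.fromRows A B) 𝒰 s 𝒱)
    (θ : Fin n → ℝ) : nrm (B *ᵥ θ) ≤ nrm (Matrix.diagonal s *ᵥ (𝒱ᵀ *ᵥ θ)) := by
  rw [h.mulVec_snd, toRows₂_mulVec]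
  exact (nrm_comp_inr_le _).trans_eq (nrm_mulVec_of_transpose_mul_self h.left_orthonormal _)

/-- Combined with full row rank this gives `b ≤ r`, which collapses the target dimension when there
is one user. -/
theorem IsCompactSVD.rank_snd_le (h : IsCompactSVD (Matrix.fromRows A B) 𝒰 s 𝒱) :
    B.rank ≤ r := by
  have hB : B = 𝒰.toRows₂ * (Matrix.diagonal s * 𝒱ᵀ) := by
    apply Matrix.ext_of_mulVec_single
    intro i
    rw [h.mulVec_snd]
    simp only [Matrix.mulVec_mulVec]
  rw [hB]
  exact (Matrix.rank_mul_le_left _ _).trans (by simpa using Matrix.rank_le_card_width 𝒰.toRows₂)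

end SVD

theorem stacked_sub_mulVec (A : Matrix (Fin a) (Fin n) ℝ) (θ : Fin p → Fin n → ℝ)
    (Y Y' : Fin p → Fin b → ℝ) (w : Fin p → ℝ) :
    stacked A θ Y *ᵥ w - stacked A θ Y' *ᵥ w =
      Sum.elim (0 : Fin a → ℝ) (∑ j, w j • (Y j - Y' j)) := by
  ext i
  cases i with
  | inl i => simp [stacked, Matrix.mulVec, dotProduct]
  | inr i =>
    simp only [stacked, Matrix.mulVec, dotProduct, Matrix.fromRows_apply_inr, Matrix.of_apply,
      Pi.sub_apply, Sum.elim_inr, Finset.sum_apply, Pi.smul_apply, smul_eq_mul]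
    rw [← Finset.sum_sub_distrib]
    exact Finset.sum_congr rfl fun _ _ => by ring

/-- Cauchy–Schwarz in each coordinate: the Frobenius norm dominates the operator norm. -/
theorem nrm_sum_smul_le (w : Fin p → ℝ) (E : Fin p → Fin b → ℝ) {f : ℝ} (hf : 0 ≤ f)
    (hE : ∑ j, nrm (E j) ^ 2 ≤ f ^ 2) : nrm (∑ j, w j • E j) ≤ f * nrm w := by
  apply nrm_le_of_sq_le (mul_nonneg hf (nrm_nonneg _))
  rw [nrm_sq_eq_sum, mul_pow]
  have h1 : ∀ i, (∑ j, w j • E j) i ^ 2 ≤ nrm w ^ 2 * ∑ j, E j i ^ 2 := by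
    intro i
    rw [Finset.sum_apply, nrm_sq_eq_sum]
    exact Finset.sum_mul_sq_le_sq_mul_sq _ _ _
  refine (Finset.sum_le_sum fun i _ => h1 i).trans ?_
  rw [← Finset.mul_sum, Finset.sum_comm, mul_comm]
  refine mul_le_mul_of_nonneg_right ?_ (sq_nonneg _)
  simpa only [nrm_sq_eq_sum] using hE

/-- The bound of the theorem exceeds the trivial bound unless `√2 Z` is small. -/
theorem gap_le_of_nontrivial {q σ Z c f : ℝ} (hq : 0 < q) (hqσ : q < σ) (hZ : Z = q / (σ - q))
    (hc : √2 * Z < c) (hc1 : c ≤ 1) (hf : f ^ 2 ≤ 8 / 5 * q ^ 2)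
    (hnt : √2 * Z * (1 + (c - √2 * Z)⁻¹) < 1) : f < σ ∧ f / (σ - f) ≤ √2 * Z := by
  have hσq : 0 < σ - q := by linarith
  have hZ0 : 0 < Z := hZ ▸ div_pos hq hσq
  have h2 : (1.414 : ℝ) < √2 := Real.lt_sqrt_of_sq_lt (by norm_num)
  set x := √2 * Z with hx
  have hx0 : 0 < x := by positivity
  have hinv : (1 - x)⁻¹ ≤ (c - x)⁻¹ := inv_anti₀ (by linarith) (by linarith)
  have hx1 : 0 < 1 - x := by linarith
  have h3 : x * (1 + (1 - x)⁻¹) < 1 := by nlinarith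
  have h4 : x * (1 - x) + x < 1 - x := by
    have := mul_lt_mul_of_pos_right h3 hx1
    have e : x * (1 + (1 - x)⁻¹) * (1 - x) = x * (1 - x) + x := by field_simp
    linarith
  -- The preceding inequality reads `x² - 3x + 1 > 0`, so `x < (3 - √5)/2 < 2/5`. Hence `Z < 0.283`
  -- and `σ = q (1 + 1/Z) > 4.53 q`. The final comparison, with `1.265 > √(8/5)` and `1.414 < √2`,
  -- needs only about `σ ≥ 3.52 q`.
  have hx25 : x < 2 / 5 := by nlinarith
  have hZq : Z * (σ - q) = q := by rw [hZ]; field_simp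
  have hZ' : Z < 0.283 := by nlinarith
  have hσ : 4.53 * q < σ := by nlinarith
  have hf' : f ≤ 1.265 * q := by
    apply le_of_sq_le_sq _ (by positivity)
    nlinarith [sq_nonneg q]
  have hfσ : f < σ := by nlinarith
  refine ⟨hfσ, ?_⟩
  rw [div_le_iff₀ (by linarith), hx, hZ]
  have : 1.414 * q * (σ - f) ≤ √2 * q * (σ - f) := by
    have : 0 < q * (σ - f) := mul_pos hq (by linarith)
    nlinarith
  rw [mul_div_assoc', div_mul_eq_mul_div, le_div_iff₀ hσq]
  have h5 : f * (σ - q) ≤ 1.265 * q * (σ - q) := mul_le_mul_of_nonneg_right hf' hσq.le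
  have h6 : 1.414 * q * (σ - 1.265 * q) ≤ 1.414 * q * (σ - f) :=
    mul_le_mul_of_nonneg_left (by linarith) (by positivity)
  have h7 : 1.265 * q * (σ - q) ≤ 1.414 * q * (σ - 1.265 * q) := by nlinarith
  linarith

/-- The perturbation bound for the learned subspace when the error of the estimated matrix is small
compared with the gap. -/
theorem tailMass_le_of_gap {A : Matrix (Fin a) (Fin n) ℝ} {B : Matrix (Fin b) (Fin n) ℝ}
    {𝒰 : Matrix (Fin a ⊕ Fin b) (Fin r) ℝ} {s : Fin r → ℝ} {𝒱 : Matrix (Fin n) (Fin r) ℝ}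
    (hSVD : IsCompactSVD (Matrix.fromRows A B) 𝒰 s 𝒱) (ha : 0 < a) (hr : 0 < r)
    (θ₀ : Fin p → Fin n → ℝ) (Y : Fin p → Fin b → ℝ) {f x : ℝ} (hf0 : 0 ≤ f)
    (hf : ∑ j, nrm (Y j - B *ᵥ θ₀ j) ^ 2 ≤ f ^ 2)
    (hfσ : f < sigma (stacked A θ₀ fun j => B *ᵥ θ₀ j) r)
    (hx : f / (sigma (stacked A θ₀ fun j => B *ᵥ θ₀ j) r - f) ≤ x)
    (hxc : x < sigma 𝒰.toRows₁ a) {V : Matrix (Fin a ⊕ Fin b) (Fin r) ℝ}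
    (hV : IsTopLeftSingular (stacked A θ₀ Y) V) {P : Matrix (Fin r) (Fin a) ℝ}
    (hP : IsMoorePenrose V.toRows₁ P) (θ : Fin n → ℝ) {d : ℕ} {W : Matrix (Fin b) (Fin b) ℝ}
    (hW : IsAdaptedBasis (learnedSubspace V P (A *ᵥ θ)) d W) :
    tailMass d W (B *ᵥ θ) ≤
      x * (1 + (sigma 𝒰.toRows₁ a - x)⁻¹) * nrm (Matrix.diagonal s *ᵥ (𝒱ᵀ *ᵥ θ)) := by
  set M := stacked A θ₀ fun j => B *ᵥ θ₀ j with hM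
  set κ := f / (sigma M r - f) with hκ
  set c := sigma 𝒰.toRows₁ a with hc
  have hκ0 : 0 ≤ κ := div_nonneg hf0 (by linarith)
  have hc0 : 0 < c := by linarith
  have hc1 := sigma_toRows₁_le_one hSVD.left_orthonormal ha hc0
  have herr : ∀ w, nrm (stacked A θ₀ Y *ᵥ w - M *ᵥ w) ≤ f * nrm w := by
    intro w
    rw [hM, stacked_sub_mulVec, nrm_elim_zero_left]
    exact nrm_sum_smul_le w _ hf0 hf
  have hVV := hV.transpose_mul_self
  have hgap := nrm_sub_proj_le_symm hSVD.left_orthonormal hVV hκ0 (by linarith) fun y =>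
    nrm_sub_proj_le_of_exists_preimage (V := V) hSVD.left_orthonormal (hSVD.stacked_eq θ₀) herr hf0
      (sub_pos.2 hfσ) y (hV.exists_preimage hr herr hf0 hfσ y)
  have hγ : 0 < c - κ := by linarith
  have hX : ∀ y, (c - κ) * nrm y ≤ nrm (V.toRows₁ᵀ *ᵥ y) := by
    intro y
    have h1 := nrm_transpose_mulVec_le_add hSVD.left_orthonormal hVV hκ0 hgap (Sum.elim y 0)
    rw [← toRows₁_transpose_mulVec, ← toRows₁_transpose_mulVec, nrm_elim_zero] at h1
    have h2 := sigma_mul_nrm_le_transpose ha hc0 y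
    linarith
  obtain ⟨e, he, hle⟩ := exists_mem_learnedSubspace_nrm_sub_le hVV hγ hgap hX hP
    (Matrix.diagonal s *ᵥ (𝒱ᵀ *ᵥ θ))
  rw [← hSVD.mulVec_fst] at he
  rw [← hSVD.mulVec_snd] at hle
  refine (hW.tailMass_le _ he).trans (hle.trans (mul_le_mul_of_nonneg_right ?_ (nrm_nonneg _)))
  have hinv : (c - κ)⁻¹ ≤ (c - x)⁻¹ := inv_anti₀ (by linarith) (by linarith)
  exact mul_le_mul hx (by linarith) (by positivity) (by linarith)

/-- The rectangular diagonal factor has a single column, so only its top entry can be nonzero. -/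
theorem IsTopLeftSingular.exists_smul_col {Y : Matrix (Fin a ⊕ Fin b) (Fin 1) ℝ}
    {V : Matrix (Fin a ⊕ Fin b) (Fin 1) ℝ} (h : IsTopLeftSingular Y V) :
    ∃ t : ℝ, ∀ i, Y i 0 = V i 0 * t := by
  obtain ⟨hr, P, Q, s, -, -, -, -, -, -, hY, rfl⟩ := h
  refine ⟨s 0 * Q 0 0, fun i => ?_⟩
  rw [hY, Matrix.mul_assoc, Matrix.mul_apply, Finset.sum_eq_single (Fin.castLE hr 0)]
  · simp [Matrix.mul_apply]
  · intro k _ hk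
    have : (k : ℕ) ≠ 0 := fun h0 => hk (Fin.ext h0)
    simp [Matrix.mul_apply, this]
  · simp

theorem nrm_fin_one (v : Fin 1 → ℝ) : nrm v = |v 0| := by
  rw [← abs_of_nonneg (nrm_nonneg v), ← sq_eq_sq_iff_abs_eq_abs, nrm_sq_eq_sum, Fin.sum_univ_one]

theorem mulVec_fin_one {m : Type*} (X : Matrix m (Fin 1) ℝ) (w : Fin 1 → ℝ) (i : m) :
    (X *ᵥ w) i = X i 0 * w 0 := by
  simp [Matrix.mulVec, dotProduct]

/-- With one user the source, the target and the joint representation are all one-dimensional, and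
the learned subspace is everything unless the estimate of the target reward vanishes. -/
theorem tailMass_le_of_one_user {A B : Matrix (Fin 1) (Fin n) ℝ}
    {𝒰 : Matrix (Fin 1 ⊕ Fin 1) (Fin 1) ℝ} {s : Fin 1 → ℝ} {𝒱 : Matrix (Fin n) (Fin 1) ℝ}
    (hSVD : IsCompactSVD (Matrix.fromRows A B) 𝒰 s 𝒱)
    (θ₀ : Fin 1 → Fin n → ℝ) (Y : Fin 1 → Fin 1 → ℝ) {q x : ℝ} (hq : 0 < q)
    (hf : ∑ j, nrm (Y j - B *ᵥ θ₀ j) ^ 2 ≤ 16 / 5 * q ^ 2)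
    (hqσ : q < sigma (stacked A θ₀ fun j => B *ᵥ θ₀ j) 1)
    (hx : x = √2 * (q / (sigma (stacked A θ₀ fun j => B *ᵥ θ₀ j) 1 - q)))
    (hxc : x < sigma 𝒰.toRows₁ 1) {V : Matrix (Fin 1 ⊕ Fin 1) (Fin 1) ℝ}
    (hV : IsTopLeftSingular (stacked A θ₀ Y) V) {P : Matrix (Fin 1) (Fin 1) ℝ}
    (hP : IsMoorePenrose V.toRows₁ P) (θ : Fin n → ℝ) {d : ℕ} {W : Matrix (Fin 1) (Fin 1) ℝ}
    (hW : IsAdaptedBasis (learnedSubspace V P (A *ᵥ θ)) d W) :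
    tailMass d W (B *ᵥ θ) ≤
      x * (1 + (sigma 𝒰.toRows₁ 1 - x)⁻¹) * nrm (Matrix.diagonal s *ᵥ (𝒱ᵀ *ᵥ θ)) := by
  set σ := sigma (stacked A θ₀ fun j => B *ᵥ θ₀ j) 1 with hσ
  set c := sigma 𝒰.toRows₁ 1 with hc
  set φ := Matrix.diagonal s *ᵥ (𝒱ᵀ *ᵥ θ) with hφ
  have hσq : 0 < σ - q := by linarith
  have hx0 : 0 < x := by rw [hx]; positivity
  have hc0 : 0 < c := by linarith
  have hc1 := sigma_toRows₁_le_one hSVD.left_orthonormal one_pos hc0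
  have hBφ : nrm (B *ᵥ θ) = |𝒰 (Sum.inr 0) 0| * nrm φ := by
    have : B *ᵥ θ = 𝒰 (Sum.inr 0) 0 • φ := by
      rw [hSVD.mulVec_snd, ← hφ]
      ext i
      rw [Subsingleton.elim i 0]
      simp [Matrix.mulVec, dotProduct, Matrix.toRows₂]
    rw [this, nrm_smul]
  have hnn : 0 ≤ x * (1 + (c - x)⁻¹) * nrm φ := by
    have : 0 < (c - x)⁻¹ := inv_pos.2 (by linarith)
    have := nrm_nonneg φ
    positivity
  -- If the target entry of `V` vanishes, so does the estimate `Y 0`, and the error is `B θ₀`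
  -- itself. The error bound then makes the target entry of `𝒰` at most `2 x`, and the trivial bound
  -- suffices. Otherwise `B θ` lies in the learned subspace and the loss is zero.
  by_cases hβ : V (Sum.inr 0) 0 = 0
  · refine (tailMass_le_nrm hW.1 d _).trans ?_
    rw [hBφ]
    refine mul_le_mul_of_nonneg_right ?_ (nrm_nonneg _)
    obtain ⟨t, ht⟩ := hV.exists_smul_col
    have hY0 : Y 0 = 0 := by
      ext i
      rw [Subsingleton.elim i 0]
      have := ht (Sum.inr 0)
      rw [hβ, zero_mul] at this
      exact this
    set φ₀ := Matrix.diagonal s *ᵥ (𝒱ᵀ *ᵥ θ₀ 0) with hφ₀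
    have hB₀ : B *ᵥ θ₀ 0 = 𝒰 (Sum.inr 0) 0 • φ₀ := by
      rw [hSVD.mulVec_snd, ← hφ₀]
      ext i
      rw [Subsingleton.elim i 0]
      simp [Matrix.mulVec, dotProduct, Matrix.toRows₂]
    have h1 : (|𝒰 (Sum.inr 0) 0| * nrm φ₀) ^ 2 ≤ 16 / 5 * q ^ 2 := by
      simpa [hY0, hB₀, nrm_neg, nrm_smul] using hf
    have h2 : σ ≤ nrm φ₀ := by
      obtain ⟨L, hL, hLX⟩ := exists_orthonormal_sigma_mul_nrm_le
        (stacked A θ₀ fun j => B *ᵥ θ₀ j) one_pos (hq.trans hqσ)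
      have h3 := hLX 1
      set K : Matrix (Fin 1) (Fin 1) ℝ :=
        Matrix.of fun k j => (Matrix.diagonal s *ᵥ (𝒱ᵀ *ᵥ θ₀ j)) k with hK
      have hKw : ∀ w : Fin 1 → ℝ, K *ᵥ w = w 0 • φ₀ := by
        intro w
        ext i
        rw [mulVec_fin_one, mul_comm]; rfl
      have h4 : nrm (L *ᵥ (1 : Fin 1 → ℝ)) = 1 := by
        rw [nrm_mulVec_of_transpose_mul_self hL]; simp [nrm, EuclideanSpace.norm_eq]
      have h5 : |(L *ᵥ (1 : Fin 1 → ℝ)) 0| = 1 := by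
        rw [← h4, nrm_fin_one]
      rw [← hσ, hSVD.stacked_eq, ← Matrix.mulVec_mulVec _ 𝒰,
        nrm_mulVec_of_transpose_mul_self hSVD.left_orthonormal, ← hK, hKw, nrm_smul, h5,
        one_mul] at h3
      have h6 : nrm (1 : Fin 1 → ℝ) = 1 := by simp [nrm, EuclideanSpace.norm_eq]
      rwa [h6, mul_one] at h3
    have h7 : |𝒰 (Sum.inr 0) 0| * σ ≤ 1.8 * q := by
      refine (mul_le_mul_of_nonneg_left h2 (abs_nonneg _)).trans ?_
      apply le_of_sq_le_sq _ (by positivity)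
      nlinarith [sq_nonneg q]
    have h8 : (1.414 : ℝ) < √2 := Real.lt_sqrt_of_sq_lt (by norm_num)
    have h9 : 1 ≤ (c - x)⁻¹ := (one_le_inv₀ (by linarith)).2 (by linarith)
    have h10 : x * (σ - q) = √2 * q := by rw [hx]; field_simp
    have h11 : 1.414 * q ≤ x * σ := by nlinarith
    have h12 : |𝒰 (Sum.inr 0) 0| ≤ 2 * x := by
      have : |𝒰 (Sum.inr 0) 0| * σ ≤ 2 * x * σ := by nlinarith
      exact le_of_mul_le_mul_right this (hq.trans hqσ)
    nlinarith
  · suffices h : B *ᵥ θ ∈ learnedSubspace V P (A *ᵥ θ) by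
      have := hW.tailMass_le (B *ᵥ θ) h
      rw [sub_self, nrm_zero] at this
      exact this.trans hnn
    -- If the source entry vanishes, the kernel part already fills the line. If not, the transformer
    -- sends a nonzero source vector to a nonzero target vector; when `φ` vanishes, `B θ = 0`.
    by_cases hα : V (Sum.inl 0) 0 = 0
    · refine Submodule.mem_sup_right ⟨(V (Sum.inr 0) 0)⁻¹ • (B *ᵥ θ), ?_, ?_⟩
      · change V.toRows₁ *ᵥ _ = 0
        ext i
        rw [Subsingleton.elim i 0, mulVec_fin_one, Matrix.toRows₁_apply, hα, zero_mul]; rfl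
      · change V.toRows₂ *ᵥ _ = _
        ext i
        rw [Subsingleton.elim i 0, mulVec_fin_one, Matrix.toRows₂_apply, Pi.smul_apply, smul_eq_mul,
          mul_inv_cancel_left₀ hβ]
    · refine Submodule.mem_sup_left (Submodule.mem_span_singleton.2 ?_)
      by_cases hφ0 : φ 0 = 0
      · refine ⟨0, ?_⟩
        ext i
        rw [Subsingleton.elim i 0, hSVD.mulVec_snd, ← hφ, mulVec_fin_one, hφ0]
        simp
      have hp : P 0 0 ≠ 0 := by
        intro hp
        have := congrFun (congrFun hP.mul_mul_left 0) 0
        simp [Matrix.mul_apply, hp, Matrix.toRows₁] at this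
        exact hα this.symm
      have hU : 𝒰 (Sum.inl 0) 0 ≠ 0 := by
        intro h0
        have h1 := sigma_mul_nrm_le_transpose one_pos hc0 1
        rw [nrm_fin_one, nrm_fin_one, mulVec_fin_one, ← hc, Matrix.transpose_apply,
          Matrix.toRows₁_apply, h0] at h1
        simp at h1
        linarith
      have hz : ((V.toRows₂ * P) *ᵥ (A *ᵥ θ)) 0 ≠ 0 := by
        rw [← Matrix.mulVec_mulVec, mulVec_fin_one, mulVec_fin_one,
          hSVD.mulVec_fst, ← hφ, mulVec_fin_one]
        exact mul_ne_zero hβ (mul_ne_zero hp (mul_ne_zero hU hφ0))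
      refine ⟨(B *ᵥ θ) 0 / ((V.toRows₂ * P) *ᵥ (A *ᵥ θ)) 0, ?_⟩
      ext i
      rw [Subsingleton.elim i 0, Pi.smul_apply, smul_eq_mul, div_mul_cancel₀ _ hz]

end Deterministic


/-! ### Exponential moments of Gaussian and subgaussian squares -/

section GaussianMoments

variable {κ ι Ω : Type*} [Fintype κ] [Fintype ι] [MeasurableSpace Ω]

theorem lintegral_exp_mul_sq_gaussianReal {s : ℝ} (hs : s < 1 / 2) :
    ∫⁻ x, ENNReal.ofReal (Real.exp (s * x ^ 2)) ∂gaussianReal 0 1 =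
      ENNReal.ofReal (√(1 - 2 * s))⁻¹ := by
  have hpos : 0 < 1 - 2 * s := by linarith
  obtain ⟨v, hv⟩ : ∃ v : ℝ≥0, (v : ℝ) = (1 - 2 * s)⁻¹ :=
    ⟨⟨(1 - 2 * s)⁻¹, (inv_pos.2 hpos).le⟩, rfl⟩
  have hv0 : v ≠ 0 := by
    rintro rfl
    exact (inv_pos.2 hpos).ne hv
  have hpdf : ∀ x, gaussianPDF 0 1 x * ENNReal.ofReal (Real.exp (s * x ^ 2)) =
      ENNReal.ofReal (√(1 - 2 * s))⁻¹ * gaussianPDF 0 v x := by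
    intro x
    rw [gaussianPDF, gaussianPDF, ← ENNReal.ofReal_mul (gaussianPDFReal_nonneg _ _ _),
      ← ENNReal.ofReal_mul (by positivity)]
    congr 1
    simp only [gaussianPDFReal, NNReal.coe_one, sub_zero, hv]
    rw [mul_assoc, ← Real.exp_add, Real.sqrt_mul (by positivity) (1 - 2 * s)⁻¹, Real.sqrt_inv,
      mul_one, mul_inv, inv_inv]
    have h1 : -x ^ 2 / (2 * 1) + s * x ^ 2 = -x ^ 2 / (2 * (1 - 2 * s)⁻¹) := by
      field_simp; ring
    have h2 : (√(1 - 2 * s)) ≠ 0 := (Real.sqrt_pos.2 hpos).ne'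
    rw [h1]
    field_simp
  rw [gaussianReal_of_var_ne_zero _ one_ne_zero,
    lintegral_withDensity_eq_lintegral_mul _ (measurable_gaussianPDF _ _) (by fun_prop)]
  simp only [Pi.mul_apply, hpdf]
  rw [lintegral_const_mul _ (measurable_gaussianPDF _ _), lintegral_gaussianPDF_eq_one _ hv0,
    mul_one]

theorem lintegral_exp_mul_gaussianReal (t : ℝ) :
    ∫⁻ x, ENNReal.ofReal (Real.exp (t * x)) ∂gaussianReal 0 1 =
      ENNReal.ofReal (Real.exp (t ^ 2 / 2)) := by
  rw [← ofReal_integral_eq_lintegral_ofReal (integrable_exp_mul_gaussianReal t)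
    (ae_of_all _ fun _ => (Real.exp_pos _).le)]
  have := congrFun (mgf_id_gaussianReal (μ := 0) (v := 1)) t
  simp only [mgf, id, zero_mul, NNReal.coe_one, one_mul, zero_add] at this
  rw [this]

theorem lintegral_pi_gaussianReal_prod (F : κ → ℝ → ℝ≥0∞) (hF : ∀ k, Measurable (F k)) :
    ∫⁻ g, ∏ k, F k (g k) ∂Measure.pi (fun _ : κ => gaussianReal 0 1) =
      ∏ k, ∫⁻ x, F k x ∂gaussianReal 0 1 := by
  rw [lintegral_prod_eq_prod_lintegral_of_indepFun Finset.univ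
    (fun k (g : κ → ℝ) => F k (g k)) (iIndepFun_pi fun k => (hF k).aemeasurable)
    fun k => (hF k).comp (measurable_pi_apply k)]
  exact Finset.prod_congr rfl fun k _ =>
    (measurePreserving_eval (fun _ : κ => gaussianReal 0 1) k).lintegral_comp (hF k)

theorem ofReal_exp_mul_nrm_sq (s : ℝ) (y : κ → ℝ) :
    ENNReal.ofReal (Real.exp (s * nrm y ^ 2)) = ∏ k, ENNReal.ofReal (Real.exp (s * y k ^ 2)) := by
  rw [← ENNReal.ofReal_prod_of_nonneg fun _ _ => (Real.exp_pos _).le, ← Real.exp_sum,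
    nrm_sq_eq_sum, Finset.mul_sum]

/-- Gaussian linearization of the exponential of a squared norm. -/
theorem lintegral_exp_dotProduct_gaussianReal {s : ℝ} (hs : 0 ≤ s) (y : κ → ℝ) :
    ∫⁻ g, ENNReal.ofReal (Real.exp (√(2 * s) * (g ⬝ᵥ y)))
      ∂Measure.pi (fun _ : κ => gaussianReal 0 1) =
      ENNReal.ofReal (Real.exp (s * nrm y ^ 2)) := by
  have h1 : ∀ g : κ → ℝ, ENNReal.ofReal (Real.exp (√(2 * s) * (g ⬝ᵥ y))) =
      ∏ k, ENNReal.ofReal (Real.exp (√(2 * s) * y k * g k)) := by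
    intro g
    rw [← ENNReal.ofReal_prod_of_nonneg fun _ _ => (Real.exp_pos _).le, ← Real.exp_sum,
      dotProduct, Finset.mul_sum]
    congr 2
    exact Finset.sum_congr rfl fun _ _ => by ring
  simp_rw [h1]
  rw [lintegral_pi_gaussianReal_prod (fun k x => ENNReal.ofReal (Real.exp (√(2 * s) * y k * x)))
    fun k => by fun_prop, ofReal_exp_mul_nrm_sq]
  refine Finset.prod_congr rfl fun k _ => ?_
  rw [lintegral_exp_mul_gaussianReal, mul_pow, Real.sq_sqrt (by positivity)]
  congr 2; ring

theorem lintegral_exp_sum_mul_le {μ : Measure Ω} {η : ι → Ω → ℝ} (hη : iIndepFun η μ)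
    (hsub : ∀ i, HasSubgaussianMGF (η i) 1 μ) (c : ι → ℝ) :
    ∫⁻ ω, ENNReal.ofReal (Real.exp (c ⬝ᵥ fun i => η i ω)) ∂μ ≤
      ENNReal.ofReal (Real.exp (nrm c ^ 2 / 2)) := by
  have h1 := HasSubgaussianMGF.sum_of_iIndepFun (s := Finset.univ)
    (hη.comp (fun i x => c i * x) fun i => by fun_prop) fun i _ => (hsub i).const_mul (c i)
  have h2 := h1.integrable_exp_mul 1
  have h3 := h1.mgf_le 1
  simp only [mgf, one_mul, Function.comp_apply] at h2 h3
  simp only [dotProduct]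
  rw [← ofReal_integral_eq_lintegral_ofReal h2 (ae_of_all _ fun _ => (Real.exp_pos _).le)]
  refine ENNReal.ofReal_le_ofReal (h3.trans_eq ?_)
  congr 1
  rw [nrm_sq_eq_sum]
  simp only [NNReal.coe_sum, one_pow, mul_one]
  congr 1
  exact Finset.sum_congr rfl fun i _ => mul_one (c i ^ 2)

/-- Exponential moment of the squared norm of the projection of a subgaussian vector. -/
theorem lintegral_exp_mul_nrm_sq_transpose_mulVec_le [DecidableEq κ] {μ : Measure Ω}
    [IsProbabilityMeasure μ] {η : ι → Ω → ℝ} (hη : iIndepFun η μ) (hm : ∀ i, Measurable (η i))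
    (hsub : ∀ i, HasSubgaussianMGF (η i) 1 μ) {Q : Matrix ι κ ℝ} (hQ : Qᵀ * Q = 1) {s : ℝ}
    (hs0 : 0 ≤ s) (hs : s < 1 / 2) :
    ∫⁻ ω, ENNReal.ofReal (Real.exp (s * nrm (Qᵀ *ᵥ fun i => η i ω) ^ 2)) ∂μ ≤
      ENNReal.ofReal (√(1 - 2 * s))⁻¹ ^ Fintype.card κ := by
  -- Averaging over an auxiliary Gaussian `g` makes the exponent linear in `η`. After swapping
  -- integrals, subgaussianity gives `exp (s ‖Q g‖²) = exp (s ‖g‖²)`, and a chi-square moment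
  -- remains.
  simp_rw [← lintegral_exp_dotProduct_gaussianReal hs0]
  rw [lintegral_lintegral_swap]
  · have h1 : ∀ g : κ → ℝ, ∫⁻ ω, ENNReal.ofReal
        (Real.exp (√(2 * s) * (g ⬝ᵥ Qᵀ *ᵥ fun i => η i ω))) ∂μ ≤
        ∏ k, ENNReal.ofReal (Real.exp (s * g k ^ 2)) := by
      intro g
      have h2 := lintegral_exp_sum_mul_le hη hsub (√(2 * s) • (Q *ᵥ g))
      rw [nrm_smul, mul_pow, sq_abs, Real.sq_sqrt (by positivity),
        nrm_mulVec_of_transpose_mul_self hQ] at h2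
      rw [← ofReal_exp_mul_nrm_sq]
      convert h2 using 4
      · rw [smul_dotProduct, mulVec_dotProduct, smul_eq_mul]
      · ring
    refine (lintegral_mono h1).trans_eq ?_
    rw [lintegral_pi_gaussianReal_prod (fun _ x => ENNReal.ofReal (Real.exp (s * x ^ 2)))
      fun _ => by fun_prop]
    simp [lintegral_exp_mul_sq_gaussianReal hs]
  · refine Measurable.aemeasurable ?_
    simp only [dotProduct, Matrix.mulVec, Function.uncurry_def]
    fun_prop

end GaussianMoments

/-! ### Projected noise for fixed arms -/

section Noise

variable {N b m : ℕ} {Ω : Type*} [MeasurableSpace Ω]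

-- Fitted values are an orthogonal projection of the rewards. Factoring the Gram matrix as `Rᵀ R`
-- makes `D R⁻¹` an orthonormal basis of the range of `D`.
open scoped MatrixOrder Matrix.Norms.L2Operator in
theorem exists_orthonormal_leastSquares (D : Matrix (Fin N) (Fin b) ℝ)
    (hD : IsUnit (Dᵀ * D).det) :
    ∃ Q : Matrix (Fin N) (Fin b) ℝ, Qᵀ * Q = 1 ∧
      ∀ h, D *ᵥ leastSquares D h = Q *ᵥ (Qᵀ *ᵥ h) := by
  obtain ⟨R, hR⟩ := CStarAlgebra.nonneg_iff_eq_star_mul_self.mp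
    (Matrix.posSemidef_conjTranspose_mul_self D).nonneg
  rw [Matrix.star_eq_conjTranspose, Matrix.conjTranspose_eq_transpose_of_trivial,
    Matrix.conjTranspose_eq_transpose_of_trivial] at hR
  have hRu : IsUnit R.det := by
    rw [hR, Matrix.det_mul] at hD
    exact isUnit_of_mul_isUnit_right hD
  have hRt : IsUnit Rᵀ.det := by rwa [Matrix.det_transpose]
  refine ⟨D * R⁻¹, ?_, fun h => ?_⟩
  · rw [Matrix.transpose_mul, Matrix.mul_assoc, ← Matrix.mul_assoc Dᵀ, hR,
      Matrix.mul_nonsing_inv_cancel_right _ _ hRu, ← Matrix.transpose_mul,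
      Matrix.mul_nonsing_inv _ hRu, Matrix.transpose_one]
  · rw [leastSquares, hR, Matrix.mul_inv_rev, Matrix.transpose_mul, Matrix.transpose_nonsing_inv]
    simp only [Matrix.mulVec_mulVec, Matrix.mul_assoc]

/-- A Chernoff bound with parameter `5/16`. It is chosen so that `(1 - 2 · 5/16)⁻¹ = 8/3 < e`, hence
each of the `b m` dimensions costs at most `1/2` in the exponent; dividing by `5/16` gives the
coefficients `8/5` and `16/5`. -/
theorem measure_noise_le {μ : Measure Ω} [IsProbabilityMeasure μ] {η : Fin N → Fin m → Ω → ℝ}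
    (hη : iIndepFun (fun (p : Fin N × Fin m) ω => η p.1 p.2 ω) μ)
    (hm : ∀ i j, Measurable (η i j)) (hsub : ∀ i j, HasSubgaussianMGF (η i j) 1 μ)
    (D : Matrix (Fin N) (Fin b) ℝ) {t : ℝ} (ht : 0 ≤ t) :
    μ {ω | 8 / 5 * (b * m) + 16 / 5 * t <
      ∑ j, nrm (D *ᵥ leastSquares D fun i => η i j ω) ^ 2} ≤ ENNReal.ofReal (Real.exp (-t)) := by
  classical
  -- For a singular Gram matrix the inverse is zero by convention, so the fit is zero and the event
  -- is empty.
  by_cases hD : IsUnit (Dᵀ * D).det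
  swap
  · have h0 : ∀ h, leastSquares D h = 0 := fun h => by
      rw [leastSquares, Matrix.nonsing_inv_apply_not_isUnit _ hD, Matrix.zero_mulVec]
    have hpos : 0 ≤ 8 / 5 * ((b : ℝ) * m) + 16 / 5 * t := by positivity
    simp [h0, hpos.not_gt]
  obtain ⟨Q, hQ, hQD⟩ := exists_orthonormal_leastSquares D hD
  -- All users share the arms, so the joint projection is `Q ⊗ 1`, acting on the stacked noise.
  set Q' : Matrix (Fin N × Fin m) (Fin b × Fin m) ℝ := Matrix.kronecker Q 1 with hQ'
  have hQQ : Q'ᵀ * Q' = 1 := by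
    rw [hQ', Matrix.kronecker, ← Matrix.kroneckerMap_transpose, Matrix.transpose_one]
    rw [← Matrix.mul_kronecker_mul, hQ, one_mul, Matrix.one_kronecker_one]
  have hsq : ∀ ω, ∑ j, nrm (D *ᵥ leastSquares D fun i => η i j ω) ^ 2 =
      nrm (Q'ᵀ *ᵥ fun p : Fin N × Fin m => η p.1 p.2 ω) ^ 2 := by
    intro ω
    simp_rw [hQD, nrm_mulVec_of_transpose_mul_self hQ, nrm_sq_eq_sum]
    rw [Fintype.sum_prod_type, Finset.sum_comm]
    refine Finset.sum_congr rfl fun k _ => Finset.sum_congr rfl fun j _ => ?_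
    congr 1
    simp only [Matrix.mulVec, dotProduct, Matrix.transpose_apply, Fintype.sum_prod_type, hQ',
      Matrix.kronecker, Matrix.kroneckerMap_apply, Matrix.one_apply]
    refine Finset.sum_congr rfl fun i _ => ?_
    simp
  have hexp := lintegral_exp_mul_nrm_sq_transpose_mulVec_le hη (fun p => hm p.1 p.2)
    (fun p => hsub p.1 p.2) hQQ (s := 5 / 16) (by norm_num) (by norm_num)
  have hroot : (√(1 - 2 * (5 / 16 : ℝ)))⁻¹ ≤ Real.exp (1 / 2) := by
    have h1 : (2.7182818283 : ℝ) < Real.exp 1 := Real.exp_one_gt_d9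
    have h2 : Real.exp (1 / 2) = √(Real.exp 1) := by rw [← Real.exp_half]
    rw [h2, ← Real.sqrt_inv]
    exact Real.sqrt_le_sqrt (by norm_num; linarith)
  have hbound : ENNReal.ofReal (√(1 - 2 * (5 / 16 : ℝ)))⁻¹ ^ Fintype.card (Fin b × Fin m) ≤
      ENNReal.ofReal (Real.exp (b * m / 2)) := by
    rw [← ENNReal.ofReal_pow (by positivity)]
    refine ENNReal.ofReal_le_ofReal ((pow_le_pow_left₀ (by positivity) hroot _).trans_eq ?_)
    rw [← Real.exp_nat_mul]
    congr 1
    simp; ring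
  simp_rw [hsq]
  set y : ℝ := 8 / 5 * (b * m) + 16 / 5 * t with hy
  set e : ℝ≥0∞ := ENNReal.ofReal (Real.exp (5 / 16 * y)) with he
  have he0 : e ≠ 0 := by simp [he, Real.exp_pos]
  have hmarkov := mul_meas_ge_le_lintegral (μ := μ) (f := fun ω => ENNReal.ofReal
    (Real.exp (5 / 16 * nrm (Q'ᵀ *ᵥ fun p : Fin N × Fin m => η p.1 p.2 ω) ^ 2)))
    (by
      simp only [nrm_sq_eq_sum, Matrix.mulVec, dotProduct]
      fun_prop) e
  have hsubset : {ω | y < nrm (Q'ᵀ *ᵥ fun p : Fin N × Fin m => η p.1 p.2 ω) ^ 2} ⊆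
      {ω | e ≤ ENNReal.ofReal
        (Real.exp (5 / 16 * nrm (Q'ᵀ *ᵥ fun p : Fin N × Fin m => η p.1 p.2 ω) ^ 2))} := by
    intro ω hω
    refine ENNReal.ofReal_le_ofReal (Real.exp_le_exp.2 ?_)
    have : y < _ := hω
    linarith
  have h1 : e * μ {ω | y < nrm (Q'ᵀ *ᵥ fun p : Fin N × Fin m => η p.1 p.2 ω) ^ 2} ≤
      e * ENNReal.ofReal (Real.exp (-t)) := by
    refine (mul_le_mul_right (measure_mono hsubset) e).trans
      (hmarkov.trans ((hexp.trans hbound).trans_eq ?_))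
    rw [he, ← ENNReal.ofReal_mul (Real.exp_pos _).le, ← Real.exp_add, hy]
    congr 2; ring
  exact (ENNReal.mul_le_mul_iff_right he0 ENNReal.ofReal_ne_top).1 h1

end Noise


/-! ### Gaussian images of a unit vector and chi-square tails -/

section GaussianRows

variable {N b : ℕ} {Ω : Type*} [MeasurableSpace Ω] {μ : Measure Ω}
  {D : Ω → Matrix (Fin N) (Fin b) ℝ}

/-- The coordinates of `D v` are independent Gaussian variables. -/
theorem iIndepFun_mulVec_gaussian [IsProbabilityMeasure μ] (hb : 0 < b)
    (hm : ∀ i k, Measurable fun ω => D ω i k)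
    (hlaw : ∀ i k, μ.map (fun ω => D ω i k) = gaussianReal 0 (1 / (b : ℝ≥0)))
    (hind : iIndepFun (fun (p : Fin N × Fin b) ω => D ω p.1 p.2) μ) {v : Fin b → ℝ}
    (hv : nrm v = 1) :
    iIndepFun (fun i ω => √b * (D ω *ᵥ v) i) μ ∧
      ∀ i, μ.map (fun ω => √b * (D ω *ᵥ v) i) = gaussianReal 0 1 := by
  have hb' : (0 : ℝ) < b := Nat.cast_pos.2 hb
  have hG : ∀ p : Fin N × Fin b, HasGaussianLaw (fun ω => D ω p.1 p.2) μ := fun p =>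
    (⟨(hm p.1 p.2).aemeasurable, hlaw p.1 p.2⟩ : HasLaw _ _ μ).hasGaussianLaw
  have hL2 : ∀ p : Fin N × Fin b, MemLp (fun ω => D ω p.1 p.2) 2 μ := fun p =>
    (hG p).memLp (by simp)
  have hmean : ∀ p : Fin N × Fin b, ∫ ω, D ω p.1 p.2 ∂μ = 0 := by
    intro p
    have h := integral_map (μ := μ) (hm p.1 p.2).aemeasurable
      (f := fun x : ℝ => x) (by fun_prop)
    rw [hlaw, integral_id_gaussianReal] at h
    exact h.symm
  have hvar : ∀ p : Fin N × Fin b, Var[fun ω => D ω p.1 p.2; μ] = 1 / (b : ℝ) := by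
    intro p
    have h := variance_map (μ := μ) (X := fun x : ℝ => x) (Y := fun ω => D ω p.1 p.2)
      (by fun_prop) (hm p.1 p.2).aemeasurable
    rw [hlaw, variance_fun_id_gaussianReal] at h
    rw [← Function.comp_def (fun x : ℝ => x)]
    rw [← h]; simp
  have hcov : ∀ p p' : Fin N × Fin b,
      cov[fun ω => D ω p.1 p.2, fun ω => D ω p'.1 p'.2; μ] = if p = p' then 1 / (b : ℝ) else 0 := by
    intro p p'
    split_ifs with h
    · subst h
      rw [covariance_self (hm _ _).aemeasurable, hvar]
    · exact (hind.indepFun h).covariance_eq_zero (hL2 p) (hL2 p')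
  have hY : ∀ i ω, √b * (D ω *ᵥ v) i = ∑ k, √b * v k * D ω i k := by
    intro i ω
    rw [Matrix.mulVec, dotProduct, Finset.mul_sum]
    exact Finset.sum_congr rfl fun _ _ => by ring
  have hcovY : ∀ i j, cov[fun ω => √b * (D ω *ᵥ v) i, fun ω => √b * (D ω *ᵥ v) j; μ] =
      if i = j then 1 else 0 := by
    intro i j
    simp_rw [hY]
    rw [covariance_fun_sum_fun_sum (fun k => (hL2 (i, k)).const_mul _)
      fun k => (hL2 (j, k)).const_mul _]
    simp_rw [covariance_const_mul_left, covariance_const_mul_right, hcov (i, _) (j, _)]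
    split_ifs with h
    · subst h
      have h1 : ∑ k, v k ^ 2 = 1 := by rw [← nrm_sq_eq_sum, hv, one_pow]
      simp only [Prod.mk.injEq, true_and, mul_ite, mul_zero, Finset.sum_ite_eq, Finset.mem_univ,
        if_true]
      rw [← h1]
      refine Finset.sum_congr rfl fun k _ => ?_
      field_simp
      rw [Real.sq_sqrt hb'.le, h1]
      ring
    · simp [h]
  have hjoint : HasGaussianLaw (fun ω (i : Fin N) => √b * (D ω *ᵥ v) i) μ := by
    let L : (Fin N × Fin b → ℝ) →L[ℝ] (Fin N → ℝ) :=
      ContinuousLinearMap.pi fun i => ∑ k, (√b * v k) • ContinuousLinearMap.proj (i, k)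
    have h := (hind.hasGaussianLaw hG).map_of_measurable L L.continuous.measurable
    convert h using 1
    ext ω i
    rw [hY]
    simp [L]
  -- For jointly Gaussian variables, zero covariance gives independence.
  refine ⟨hjoint.iIndepFun_of_covariance_eq_zero fun i j hij => by rw [hcovY, if_neg hij],
    fun i => ?_⟩
  have hi : HasGaussianLaw (fun ω => √b * (D ω *ᵥ v) i) μ := hjoint.eval i
  have hmY : Measurable fun ω => √b * (D ω *ᵥ v) i := by
    simp_rw [hY]; fun_prop
  rw [hi.map_eq_gaussianReal, ← covariance_self hmY.aemeasurable, hcovY, if_pos rfl]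
  have : ∫ ω, √b * (D ω *ᵥ v) i ∂μ = 0 := by
    simp_rw [hY]
    rw [integral_finsetSum _ fun k _ => ((hL2 (i, k)).integrable (by norm_num)).const_mul _]
    exact Finset.sum_eq_zero fun k _ => by rw [integral_const_mul, hmean (i, k), mul_zero]
  rw [this]
  simp

/-- Equivalent to `exp (-(2s + 4s²)) ≤ 1 - 2s`. For `s ≥ 0` the quadratic lower bound on `exp`
suffices after inversion; for `s < 0` the second-order error bound does. -/
theorem inv_sqrt_one_sub_le_exp {s : ℝ} (h : |s| ≤ 1 / 4) :
    (√(1 - 2 * s))⁻¹ ≤ Real.exp (s + 2 * s ^ 2) := by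
  obtain ⟨h1, h2⟩ := abs_le.1 h
  have hpos : 0 < 1 - 2 * s := by linarith
  have key : Real.exp (-(2 * s + 4 * s ^ 2)) ≤ 1 - 2 * s := by
    rcases le_or_gt 0 s with hs | hs
    · have h3 := Real.quadratic_le_exp_of_nonneg (x := 2 * s + 4 * s ^ 2) (by positivity)
      rw [Real.exp_neg, inv_le_comm₀ (Real.exp_pos _) hpos]
      refine le_trans ?_ h3
      rw [inv_le_iff_one_le_mul₀ hpos]
      have h4 : s ^ 2 ≤ s / 4 := by nlinarith
      have h5 : s ^ 3 ≤ s ^ 2 / 4 := by nlinarith [sq_nonneg s]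
      nlinarith [mul_nonneg hs (sq_nonneg s), sq_nonneg s, pow_nonneg hs 4, pow_nonneg hs 5,
        pow_nonneg hs 3]
    · have h3 := Real.abs_exp_sub_one_sub_id_le (x := -(2 * s + 4 * s ^ 2))
        (abs_le.2 ⟨by nlinarith, by nlinarith⟩)
      have h4 := (abs_le.1 h3).2
      nlinarith [sq_nonneg s, mul_nonneg (sq_nonneg s) (by linarith : 0 ≤ -s)]
  rw [inv_le_comm₀ (Real.sqrt_pos.2 hpos) (Real.exp_pos _), ← Real.exp_neg]
  apply Real.le_sqrt_of_sq_le
  rw [← Real.exp_nat_mul]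
  refine le_of_eq_of_le ?_ key
  congr 1; push_cast; ring

/-- Chernoff's method; allowing either sign of `s` covers both tails at once. -/
theorem measure_chiSq_le {X : Fin N → Ω → ℝ} (hind : iIndepFun X μ) (hm : ∀ i, Measurable (X i))
    (hlaw : ∀ i, μ.map (X i) = gaussianReal 0 1) {s y : ℝ} (hs : |s| ≤ 1 / 4) :
    μ {ω | y ≤ s * (∑ i, X i ω ^ 2 - N)} ≤ ENNReal.ofReal (Real.exp (2 * s ^ 2 * N - y)) := by
  have hmom : ∫⁻ ω, ∏ i, ENNReal.ofReal (Real.exp (s * X i ω ^ 2)) ∂μ ≤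
      ENNReal.ofReal (Real.exp ((s + 2 * s ^ 2) * N)) := by
    rw [lintegral_prod_eq_prod_lintegral_of_indepFun Finset.univ
      (fun i ω => ENNReal.ofReal (Real.exp (s * X i ω ^ 2)))
      (hind.comp (fun _ x => ENNReal.ofReal (Real.exp (s * x ^ 2))) fun _ => by fun_prop)
      fun i => by have := hm i; fun_prop]
    have h1 : ∀ i, ∫⁻ ω, ENNReal.ofReal (Real.exp (s * X i ω ^ 2)) ∂μ ≤
        ENNReal.ofReal (Real.exp (s + 2 * s ^ 2)) := by
      intro i
      have h2 := lintegral_map (μ := μ) (f := fun x => ENNReal.ofReal (Real.exp (s * x ^ 2)))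
        (by fun_prop) (hm i)
      rw [← h2, hlaw, lintegral_exp_mul_sq_gaussianReal (by linarith [(abs_le.1 hs).2])]
      exact ENNReal.ofReal_le_ofReal (inv_sqrt_one_sub_le_exp hs)
    refine (Finset.prod_le_prod' fun i _ => h1 i).trans_eq ?_
    rw [Finset.prod_const, ← ENNReal.ofReal_pow (Real.exp_pos _).le, ← Real.exp_nat_mul]
    simp [mul_comm]
  set e : ℝ≥0∞ := ENNReal.ofReal (Real.exp (y + s * N)) with he
  have he0 : e ≠ 0 := by simp [he, Real.exp_pos]
  have hmarkov := mul_meas_ge_le_lintegral (μ := μ)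
    (f := fun ω => ∏ i, ENNReal.ofReal (Real.exp (s * X i ω ^ 2))) (by fun_prop) e
  have hsubset : {ω | y ≤ s * (∑ i, X i ω ^ 2 - N)} ⊆
      {ω | e ≤ ∏ i, ENNReal.ofReal (Real.exp (s * X i ω ^ 2))} := by
    intro ω hω
    change e ≤ _
    rw [← ENNReal.ofReal_prod_of_nonneg fun _ _ => (Real.exp_pos _).le, ← Real.exp_sum,
      ← Finset.mul_sum]
    refine ENNReal.ofReal_le_ofReal (Real.exp_le_exp.2 ?_)
    have : y ≤ s * (∑ i, X i ω ^ 2 - N) := hω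
    linarith
  have h1 : e * μ {ω | y ≤ s * (∑ i, X i ω ^ 2 - N)} ≤
      e * ENNReal.ofReal (Real.exp (2 * s ^ 2 * N - y)) := by
    refine (mul_le_mul_right (measure_mono hsubset) e).trans (hmarkov.trans (hmom.trans_eq ?_))
    rw [he, ← ENNReal.ofReal_mul (Real.exp_pos _).le, ← Real.exp_add]
    congr 2; ring
  exact (ENNReal.mul_le_mul_iff_right he0 ENNReal.ofReal_ne_top).1 h1

/-- Two-sided concentration of a chi-square variable. -/
theorem measure_abs_chiSq_sub_ge_le {X : Fin N → Ω → ℝ} (hind : iIndepFun X μ)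
    (hm : ∀ i, Measurable (X i)) (hlaw : ∀ i, μ.map (X i) = gaussianReal 0 1) {x : ℝ}
    (hx0 : 0 ≤ x) (hx1 : x ≤ 1) :
    μ {ω | x * N ≤ |∑ i, X i ω ^ 2 - N|} ≤ ENNReal.ofReal (2 * Real.exp (-(N * x ^ 2 / 8))) := by
  -- The value `s = x/4` minimises the exponent `2 s² N - s x N`.
  have h1 := measure_chiSq_le hind hm hlaw (s := x / 4) (y := x / 4 * (x * N))
    (by rw [abs_of_nonneg (by linarith)]; linarith)
  have h2 := measure_chiSq_le hind hm hlaw (s := -(x / 4)) (y := x / 4 * (x * N))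
    (by rw [abs_neg, abs_of_nonneg (by linarith)]; linarith)
  have e1 : 2 * (x / 4) ^ 2 * N - x / 4 * (x * N) = -(N * x ^ 2 / 8) := by ring
  have e2 : 2 * (-(x / 4)) ^ 2 * N - x / 4 * (x * N) = -(N * x ^ 2 / 8) := by ring
  rw [e1] at h1
  rw [e2] at h2
  rw [two_mul, ENNReal.ofReal_add (Real.exp_pos _).le (Real.exp_pos _).le]
  refine (measure_mono ?_).trans ((measure_union_le _ _).trans (add_le_add h1 h2))
  intro ω hω
  have hω' : x * N ≤ |∑ i, X i ω ^ 2 - N| := hω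
  rcases le_abs.1 hω' with h | h
  · exact Or.inl (mul_le_mul_of_nonneg_left h (by linarith))
  · refine Or.inr ?_
    change x / 4 * (x * N) ≤ -(x / 4) * (∑ i, X i ω ^ 2 - N)
    rw [neg_mul, ← mul_neg]
    exact mul_le_mul_of_nonneg_left h (by linarith)

end GaussianRows


/-! ### Nets of the sphere and quadratic forms -/

section Net

variable {b : ℕ}

/-- A `1/2`-net of the unit sphere. -/
theorem exists_sphere_net (b : ℕ) :
    ∃ s : Finset (Fin b → ℝ), s.card ≤ 5 ^ b ∧ (∀ v ∈ s, nrm v = 1) ∧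
      ∀ u, nrm u = 1 → ∃ v ∈ s, nrm (v - u) ≤ 1 / 2 := by
  classical
  let A : Set ℕ := {k | ∃ s : Finset (Fin b → ℝ), s.card = k ∧ (∀ v ∈ s, nrm v = 1) ∧
    ∀ v ∈ s, ∀ w ∈ s, v ≠ w → 1 / 2 ≤ nrm (v - w)}
  have hA : ∀ k ∈ A, k ≤ 5 ^ b := by
    rintro k ⟨s, rfl, hs, hsep⟩
    have hinj : Function.Injective fun v : Fin b → ℝ => (2 : ℝ) • WithLp.toLp 2 v := by
      intro v w h
      exact WithLp.toLp_injective 2 (smul_right_injective _ two_ne_zero h)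
    -- Doubling turns `1/2`-separated unit vectors into `1`-separated points of the ball of radius
    -- `2`, of which there are at most `5 ^ b`. A separated set of maximal cardinality is then a
    -- net.
    have h := Besicovitch.card_le_of_separated
      (s.image fun v : Fin b → ℝ => (2 : ℝ) • WithLp.toLp 2 v) ?_ ?_
    · rwa [Finset.card_image_of_injective _ hinj, finrank_euclideanSpace, Fintype.card_fin] at h
    · intro c hc
      obtain ⟨v, hv, rfl⟩ := Finset.mem_image.1 hc
      have := hs v hv
      rw [nrm] at this
      rw [norm_smul, this]; norm_num
    · intro c hc d hd hcd
      obtain ⟨v, hv, rfl⟩ := Finset.mem_image.1 hc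
      obtain ⟨w, hw, rfl⟩ := Finset.mem_image.1 hd
      have := hsep v hv w hw (fun h => hcd (by rw [h]))
      rw [nrm, WithLp.toLp_sub] at this
      rw [← smul_sub, norm_smul]
      norm_num
      linarith
  have hne : A.Nonempty := ⟨0, ∅, by simp⟩
  have hbdd : BddAbove A := ⟨5 ^ b, hA⟩
  obtain ⟨s, hcard, hs, hsep⟩ := Nat.sSup_mem hne hbdd
  refine ⟨s, hcard ▸ hA _ (Nat.sSup_mem hne hbdd), hs, fun u hu => ?_⟩
  by_contra! hfar
  have hus : u ∉ s := fun h => by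
    have := hfar u h
    rw [sub_self, nrm_zero] at this
    norm_num at this
  have hmem : s.card + 1 ∈ A := by
    refine ⟨insert u s, Finset.card_insert_of_notMem hus, ?_, ?_⟩
    · intro v hv
      rcases Finset.mem_insert.1 hv with rfl | hv
      · exact hu
      · exact hs v hv
    · intro v hv w hw hvw
      rcases Finset.mem_insert.1 hv with rfl | hv' <;> rcases Finset.mem_insert.1 hw with rfl | hw'
      · exact absurd rfl hvw
      · rw [nrm_sub_comm]; exact (hfar w hw').le
      · exact (hfar v hv').le
      · exact hsep v hv' w hw' hvw
  have := le_csSup hbdd hmem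
  omega

/-- A quadratic form that is small on a net is small on the sphere. -/
theorem abs_quadForm_le_of_net (S : Matrix (Fin b) (Fin b) ℝ) {s : Finset (Fin b → ℝ)}
    (hnet : ∀ u, nrm u = 1 → ∃ v ∈ s, nrm (v - u) ≤ 1 / 2) (hs : ∀ v ∈ s, nrm v = 1) {x : ℝ}
    (hx : ∀ v ∈ s, |v ⬝ᵥ S *ᵥ v| ≤ x) (u : Fin b → ℝ) :
    |u ⬝ᵥ S *ᵥ u| ≤ 4 * x * nrm u ^ 2 := by
  set Q : (Fin b → ℝ) → ℝ := fun v => v ⬝ᵥ S *ᵥ v with hQ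
  have hQsmul : ∀ (c : ℝ) v, Q (c • v) = c ^ 2 * Q v := by
    intro c v
    simp only [hQ, Matrix.mulVec_smul, smul_dotProduct, dotProduct_smul, smul_eq_mul]; ring
  by_cases hu0 : u = 0
  · subst hu0; simp
  have hcompact : IsCompact {v : Fin b → ℝ | nrm v = 1} := by
    have h1 : IsCompact (Metric.sphere (0 : EuclideanSpace ℝ (Fin b)) 1) := isCompact_sphere _ _
    have h2 := h1.image (PiLp.continuous_ofLp 2 (fun _ : Fin b => ℝ))
    convert h2 using 1
    ext v
    constructor
    · intro hv
      exact ⟨WithLp.toLp 2 v, by simpa [nrm] using hv, rfl⟩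
    · rintro ⟨w, hw, rfl⟩
      simpa [nrm] using hw
  have hunit : ∀ v : Fin b → ℝ, v ≠ 0 → nrm ((nrm v)⁻¹ • v) = 1 := by
    intro v hv
    rw [nrm_smul, abs_of_pos (inv_pos.2 (nrm_pos hv)), inv_mul_cancel₀ (nrm_pos hv).ne']
  have hQc : Continuous Q := by
    simp only [hQ, Matrix.mulVec, dotProduct]; fun_prop
  obtain ⟨e, he, hmax⟩ := hcompact.exists_isMaxOn ⟨_, hunit u hu0⟩ hQc.abs.continuousOn
  set l := |Q e| with hl
  have he1 : nrm e = 1 := he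
  have hQle : ∀ v, |Q v| ≤ l * nrm v ^ 2 := by
    intro v
    by_cases hv : v = 0
    · subst hv; simp [hQ]
    have h1 : |Q ((nrm v)⁻¹ • v)| ≤ l := hmax (hunit v hv)
    rw [hQsmul, abs_mul, abs_of_nonneg (sq_nonneg _), inv_pow, inv_mul_le_iff₀
      (pow_pos (nrm_pos hv) 2)] at h1
    linarith
  obtain ⟨ε, hε, hεl⟩ : ∃ ε : ℝ, |ε| = 1 ∧ ε * Q e = l := by
    rcases abs_cases (Q e) with ⟨h, _⟩ | ⟨h, _⟩
    · exact ⟨1, by simp, by rw [hl, h, one_mul]⟩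
    · exact ⟨-1, by simp, by rw [hl, h]; ring⟩
  have hεQ : ∀ v, |ε * Q v| = |Q v| := fun v => by rw [abs_mul, hε, one_mul]
  -- The usual Lipschitz estimate degenerates for a `1/2`-net. Instead use that `p` is a nonnegative
  -- quadratic form vanishing at the maximiser `e`, so that it grows only quadratically away from
  -- `e`.
  set p : (Fin b → ℝ) → ℝ := fun v => l * nrm v ^ 2 - ε * Q v with hp
  have hp0 : ∀ v, 0 ≤ p v := fun v => by
    have h1 := le_abs_self (ε * Q v)
    rw [hεQ] at h1
    simp only [hp]; linarith [hQle v]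
  have hp2 : ∀ v, p v ≤ 2 * l * nrm v ^ 2 := fun v => by
    have h1 := neg_abs_le (ε * Q v)
    rw [hεQ] at h1
    simp only [hp]; linarith [hQle v]
  have hpe : p e = 0 := by simp only [hp, he1, hεl]; ring
  obtain ⟨v, hvs, hv⟩ := hnet e he1
  set h := v - e with hh
  have hexpand : ∀ t : ℝ, p (e + t • h) =
      p e + t * (2 * l * (e ⬝ᵥ h) - ε * (e ⬝ᵥ S *ᵥ h + h ⬝ᵥ S *ᵥ e)) + t ^ 2 * p h := by
    intro t
    simp only [hp, hQ, nrm_sq, Matrix.mulVec_add, Matrix.mulVec_smul, add_dotProduct,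
      dotProduct_add, smul_dotProduct, dotProduct_smul, smul_eq_mul, dotProduct_comm h e]
    ring
  have h1 := hexpand 1
  rw [one_smul, hh, add_sub_cancel, ← hh] at h1
  -- Nonnegativity of `p` at `t = -1/2` bounds the linear coefficient by `p h / 2`. So `p v ≤ 3/2 p
  -- h ≤ 3/2 · 2l · 1/4 = 3/4 l`, which leaves `ε Q v ≥ l / 4`.
  have h2 := hexpand (-(1 / 2))
  have h3 := hp0 (e + (-(1 / 2) : ℝ) • h)
  have h4 := hp2 h
  have h5 : nrm h ^ 2 ≤ 1 / 4 := by
    have := nrm_nonneg h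
    nlinarith
  have hl0 : 0 ≤ l := abs_nonneg _
  have h6 : p v ≤ 3 / 4 * l := by
    have : l * nrm h ^ 2 ≤ l * (1 / 4) := mul_le_mul_of_nonneg_left h5 hl0
    linarith
  have h7 : ε * Q v ≤ x := by
    have := le_abs_self (ε * Q v)
    rw [hεQ] at this
    exact this.trans (hx v hvs)
  have h8 : l ≤ 4 * x := by
    simp only [hp, hs v hvs] at h6
    linarith
  exact (hQle u).trans (mul_le_mul_of_nonneg_right h8 (sq_nonneg _))

end Net

/-! ### Lower bound for the Gaussian design -/

section Arms

variable {N b : ℕ} {Ω : Type*} [MeasurableSpace Ω] {μ : Measure Ω} [IsProbabilityMeasure μ]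
  {D : Ω → Matrix (Fin N) (Fin b) ℝ}

/-- Smallest singular value of a Gaussian matrix. -/
theorem exists_measure_arms_le (hb : 0 < b) (hm : ∀ i k, Measurable fun ω => D ω i k)
    (hlaw : ∀ i k, μ.map (fun ω => D ω i k) = gaussianReal 0 (1 / (b : ℝ≥0)))
    (hind : iIndepFun (fun (p : Fin N × Fin b) ω => D ω p.1 p.2) μ) {δ : ℝ} (hδ0 : 0 < δ)
    (hδ1 : δ < 1) (hden : 0 < √N - 16 * (√(b : ℝ) + √(Real.log (4 / δ)))) :
    ∃ S : Set Ω, MeasurableSet S ∧ μ S ≤ ENNReal.ofReal (δ / 2) ∧ ∀ ω ∉ S, ∀ u,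
      (√N - 16 * (√(b : ℝ) + √(Real.log (4 / δ)))) * nrm u ≤ √b * nrm (D ω *ᵥ u) := by
  obtain ⟨s, hcard, hs, hnet⟩ := exists_sphere_net b
  set τ := Real.log (4 / δ) with hτ
  set g := √(b : ℝ) + √τ with hg
  have hτ0 : 0 < τ := Real.log_pos (by rw [lt_div_iff₀ hδ0]; linarith)
  have hb' : (0 : ℝ) < b := Nat.cast_pos.2 hb
  have hg0 : 0 < g := by positivity
  have hN : 0 < √(N : ℝ) := by nlinarith
  have hNN : √(N : ℝ) ^ 2 = N := Real.sq_sqrt (Nat.cast_nonneg _)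
  -- The net loses a factor `4`, so `4 x √N = 16 g` is where `C = 16` comes from. Also `N x² / 8 = 2
  -- g² ≥ 2 (b + τ)`, enough to beat the `5 ^ b` net points because `5 < e²`.
  set x : ℝ := 4 * g / √N with hx
  have hx0 : 0 ≤ x := by positivity
  have hx1 : 4 * x ≤ 1 := by
    rw [hx, mul_div_assoc', div_le_one hN]; linarith
  have hxN : 4 * x * √N = 16 * g := by rw [hx]; field_simp; ring
  have hxN' : x * √N = 4 * g := by linarith
  let S : Set Ω := ⋃ v ∈ s, {ω | x * N ≤ |∑ i, (√b * (D ω *ᵥ v) i) ^ 2 - N|}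
  have hmeas : ∀ v i, Measurable fun ω => √b * (D ω *ᵥ v) i := by
    intro v i
    simp only [Matrix.mulVec, dotProduct]
    fun_prop
  refine ⟨S, ?_, ?_, ?_⟩
  · refine s.measurableSet_biUnion fun v _ => measurableSet_le measurable_const ?_
    have := hmeas v
    fun_prop
  · have h1 : ∀ v ∈ s, μ {ω | x * N ≤ |∑ i, (√b * (D ω *ᵥ v) i) ^ 2 - N|} ≤
        ENNReal.ofReal (2 * Real.exp (-(N * x ^ 2 / 8))) := by
      intro v hv
      obtain ⟨hi, hl⟩ := iIndepFun_mulVec_gaussian hb hm hlaw hind (hs v hv)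
      exact measure_abs_chiSq_sub_ge_le hi (hmeas v) hl hx0 (by linarith)
    refine (measure_biUnion_finset_le s _).trans ((Finset.sum_le_sum h1).trans ?_)
    rw [Finset.sum_const, nsmul_eq_mul, ← ENNReal.ofReal_natCast,
      ← ENNReal.ofReal_mul (Nat.cast_nonneg _)]
    refine ENNReal.ofReal_le_ofReal ?_
    have h2 : 2 * (b + τ) ≤ N * x ^ 2 / 8 := by
      have e : N * x ^ 2 = 16 * g ^ 2 := by
        rw [← hNN, ← mul_pow, mul_comm, hxN']; ring
      have h3 : b + τ ≤ g ^ 2 := by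
        have := Real.sq_sqrt hb'.le
        have := Real.sq_sqrt hτ0.le
        have := mul_nonneg (Real.sqrt_nonneg b) (Real.sqrt_nonneg τ)
        rw [hg]; nlinarith
      linarith
    have h4 : Real.exp (-(N * x ^ 2 / 8)) ≤ Real.exp (-2) ^ b * (δ / 4) ^ 2 := by
      have h5 : δ / 4 = Real.exp (-τ) := by
        rw [Real.exp_neg, hτ, Real.exp_log (by positivity), inv_div]
      rw [h5, ← Real.exp_nat_mul, ← Real.exp_nat_mul, ← Real.exp_add]
      refine Real.exp_le_exp.2 ?_
      push_cast
      linarith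
    have h6 : (5 : ℝ) * Real.exp (-2) ≤ 1 := by
      rw [Real.exp_neg, mul_inv_le_iff₀ (Real.exp_pos _), one_mul]
      have h7 : Real.exp 2 = Real.exp 1 ^ 2 := by rw [← Real.exp_nat_mul]; norm_num
      rw [h7]
      nlinarith [Real.exp_one_gt_d9]
    have h8 : (s.card : ℝ) ≤ 5 ^ b := by exact_mod_cast hcard
    calc (s.card : ℝ) * (2 * Real.exp (-(N * x ^ 2 / 8)))
        ≤ 5 ^ b * (2 * (Real.exp (-2) ^ b * (δ / 4) ^ 2)) := by gcongr
      _ = (5 * Real.exp (-2)) ^ b * (2 * (δ / 4) ^ 2) := by rw [mul_pow]; ring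
      _ ≤ 1 * (2 * (δ / 4) ^ 2) := by
        gcongr
        exact pow_le_one₀ (by positivity) h6
      _ ≤ δ / 2 := by nlinarith
  · intro ω hω u
    have hsum : ∀ v, ∑ i, (√b * (D ω *ᵥ v) i) ^ 2 = b * nrm (D ω *ᵥ v) ^ 2 := by
      intro v
      simp_rw [mul_pow, Real.sq_sqrt hb'.le, nrm_sq_eq_sum, Finset.mul_sum]
    set T : Matrix (Fin b) (Fin b) ℝ := (b : ℝ) • ((D ω)ᵀ * D ω) - (N : ℝ) • 1 with hT
    have hTv : ∀ v, v ⬝ᵥ T *ᵥ v = b * nrm (D ω *ᵥ v) ^ 2 - N * nrm v ^ 2 := by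
      intro v
      rw [hT, Matrix.sub_mulVec, Matrix.smul_mulVec, Matrix.smul_mulVec, dotProduct_sub,
        dotProduct_smul, dotProduct_smul, Matrix.one_mulVec, ← Matrix.mulVec_mulVec,
        ← mulVec_dotProduct, nrm_sq, nrm_sq]
      simp
    have hnetb : ∀ v ∈ s, |v ⬝ᵥ T *ᵥ v| ≤ x * N := by
      intro v hv
      have : ω ∉ {ω | x * N ≤ |∑ i, (√b * (D ω *ᵥ v) i) ^ 2 - N|} := fun h =>
        hω (Set.mem_biUnion hv h)
      rw [hTv, hs v hv, one_pow, mul_one, ← hsum]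
      exact (not_le.1 this).le
    have h1 := (abs_le.1 (abs_quadForm_le_of_net T hnet hs hnetb u)).1
    rw [hTv] at h1
    apply le_of_sq_le_sq _ (mul_nonneg (Real.sqrt_nonneg _) (nrm_nonneg _))
    rw [mul_pow, mul_pow, Real.sq_sqrt hb'.le]
    -- The left side is `N (1 - 4x)²`, and `0 ≤ 1 - 4x ≤ 1`.
    have h2 : (√N - 16 * g) ^ 2 ≤ N * (1 - 4 * x) := by
      rw [← hxN]
      have : (√(N : ℝ) - 4 * x * √N) ^ 2 = √(N : ℝ) ^ 2 * (1 - 4 * x) ^ 2 := by ring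
      rw [this, hNN]
      exact mul_le_mul_of_nonneg_left (by nlinarith) (Nat.cast_nonneg _)
    have h3 := mul_le_mul_of_nonneg_right h2 (sq_nonneg (nrm u))
    linarith

end Arms


/-! ### Combining the estimates and averaging over the arms -/

section Combination

variable {a b n r p N : ℕ}

/-- The deterministic part of the theorem. For a single user the error may be larger, since then
all dimensions are one. -/
theorem tailMass_le_of_sum_error_le {A : Matrix (Fin a) (Fin n) ℝ} {B : Matrix (Fin b) (Fin n) ℝ}
    {𝒰 : Matrix (Fin a ⊕ Fin b) (Fin r) ℝ} {s : Fin r → ℝ} {𝒱 : Matrix (Fin n) (Fin r) ℝ}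
    (hSVD : IsCompactSVD (Matrix.fromRows A B) 𝒰 s 𝒱) (ha : 0 < a) (hb : 0 < b)
    (hB : B.rank = b) (θ₀ : Fin p → Fin n → ℝ) (Y : Fin p → Fin b → ℝ) {q Z : ℝ} (hq : 0 < q)
    (hone : p = 1 → ∑ j, nrm (Y j - B *ᵥ θ₀ j) ^ 2 ≤ 16 / 5 * q ^ 2)
    (hmany : p ≠ 1 → ∑ j, nrm (Y j - B *ᵥ θ₀ j) ^ 2 ≤ 8 / 5 * q ^ 2)
    (hqσ : q < sigma (stacked A θ₀ fun j => B *ᵥ θ₀ j) r)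
    (hZ : Z = q / (sigma (stacked A θ₀ fun j => B *ᵥ θ₀ j) r - q))
    (hZc : √2 * Z < sigma 𝒰.toRows₁ a) {V : Matrix (Fin a ⊕ Fin b) (Fin r) ℝ}
    (hV : IsTopLeftSingular (stacked A θ₀ Y) V) {P : Matrix (Fin r) (Fin a) ℝ}
    (hP : IsMoorePenrose V.toRows₁ P) (θ : Fin n → ℝ) {d : ℕ} {W : Matrix (Fin b) (Fin b) ℝ}
    (hW : IsAdaptedBasis (learnedSubspace V P (A *ᵥ θ)) d W) :
    tailMass d W (B *ᵥ θ) ≤ √2 * Z * (1 + (sigma 𝒰.toRows₁ a - √2 * Z)⁻¹) *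
      nrm (Matrix.diagonal s *ᵥ (𝒱ᵀ *ᵥ θ)) := by
  have hσq : 0 < sigma (stacked A θ₀ fun j => B *ᵥ θ₀ j) r - q := by linarith
  have hZ0 : 0 < √2 * Z := by rw [hZ]; positivity
  have hc0 := hZ0.trans hZc
  have hc1 := sigma_toRows₁_le_one hSVD.left_orthonormal ha hc0
  have har : a ≤ r := le_card_of_sigma_pos ha hc0
  have hr : 0 < r := by omega
  have hrp : r ≤ p := le_card_of_sigma_pos hr (hq.trans hqσ)
  have hbr : b ≤ r := hB ▸ hSVD.rank_snd_le
  by_cases hp : p = 1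
  · obtain rfl : r = 1 := by omega
    obtain rfl : a = 1 := by omega
    obtain rfl : b = 1 := by omega
    subst hp
    exact tailMass_le_of_one_user hSVD θ₀ Y hq (hone rfl) hqσ (by rw [hZ]) hZc hV hP θ hW
  · rcases le_or_gt 1 (√2 * Z * (1 + (sigma 𝒰.toRows₁ a - √2 * Z)⁻¹)) with htriv | hnt
    · refine (tailMass_le_nrm hW.1 d _).trans ((hSVD.nrm_mulVec_snd_le θ).trans ?_)
      exact le_mul_of_one_le_left (nrm_nonneg _) htriv
    · have hS : 0 ≤ ∑ j, nrm (Y j - B *ᵥ θ₀ j) ^ 2 := Finset.sum_nonneg fun _ _ => sq_nonneg _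
      have hf := Real.sq_sqrt hS
      obtain ⟨h1, h2⟩ := gap_le_of_nontrivial hq hqσ hZ hZc hc1 (hf.trans_le (hmany hp)) hnt
      exact tailMass_le_of_gap hSVD ha hr θ₀ Y (Real.sqrt_nonneg _) hf.ge h1 h2 hZc hV hP θ hW

theorem leastSquares_mulVec_add {D : Matrix (Fin N) (Fin b) ℝ} (hD : IsUnit (Dᵀ * D).det)
    (x : Fin b → ℝ) (h : Fin N → ℝ) :
    leastSquares D (fun i => D i ⬝ᵥ x + h i) = x + leastSquares D h := by
  have : (fun i => D i ⬝ᵥ x + h i) = D *ᵥ x + h := rfl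
  rw [this, leastSquares, leastSquares, Matrix.mulVec_add, Matrix.mulVec_add,
    Matrix.mulVec_mulVec x, Matrix.mulVec_mulVec, Matrix.nonsing_inv_mul _ hD, Matrix.one_mulVec]

theorem isUnit_det_transpose_mul_self {D : Matrix (Fin N) (Fin b) ℝ} {c : ℝ} (hc : 0 < c)
    {c' : ℝ} (hD : ∀ u, c * nrm u ≤ c' * nrm (D *ᵥ u)) : IsUnit (Dᵀ * D).det := by
  rw [← Matrix.isUnit_iff_isUnit_det, ← Matrix.mulVec_injective_iff_isUnit]
  change Function.Injective (Dᵀ * D).mulVecLin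
  rw [← LinearMap.ker_eq_bot, LinearMap.ker_eq_bot']
  intro u hu
  have h1 : nrm (D *ᵥ u) ^ 2 = 0 := by
    have h2 : Dᵀ *ᵥ (D *ᵥ u) = 0 := by rw [Matrix.mulVec_mulVec]; exact hu
    rw [nrm_sq, mulVec_dotProduct, h2, dotProduct_zero]
  have h3 := hD u
  rw [pow_eq_zero_iff two_ne_zero] at h1
  rw [h1, mul_zero] at h3
  have h4 := nrm_nonneg u
  exact nrm_eq_zero.1 (le_antisymm (by by_contra h5; push Not at h5; nlinarith) h4)

/-- The lower bound on `D` makes least squares exact on the signal, and converts the error of the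
fitted values into an error of the parameters. -/
theorem sum_error_le {D : Matrix (Fin N) (Fin b) ℝ} {c : ℝ} (hc : 0 < c)
    (hD : ∀ u, c * nrm u ≤ √b * nrm (D *ᵥ u)) (x : Fin p → Fin b → ℝ) (h : Fin N → Fin p → ℝ)
    {y : ℝ} (hy : ∑ j, nrm (D *ᵥ leastSquares D fun i => h i j) ^ 2 ≤ y) :
    ∑ j, nrm (leastSquares D (fun i => D i ⬝ᵥ x j + h i j) - x j) ^ 2 ≤ b * y / c ^ 2 := by
  have hunit := isUnit_det_transpose_mul_self hc hD
  rw [le_div_iff₀ (by positivity), Finset.sum_mul]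
  have h1 : ∀ j, nrm (leastSquares D (fun i => D i ⬝ᵥ x j + h i j) - x j) ^ 2 * c ^ 2 ≤
      b * nrm (D *ᵥ leastSquares D fun i => h i j) ^ 2 := by
    intro j
    rw [leastSquares_mulVec_add hunit (x j) fun i => h i j, add_sub_cancel_left, ← mul_pow,
      mul_comm]
    have h2 := pow_le_pow_left₀ (mul_nonneg hc.le (nrm_nonneg _))
      (hD (leastSquares D fun i => h i j)) 2
    rwa [mul_pow (√(b : ℝ)), Real.sq_sqrt (Nat.cast_nonneg _)] at h2
  refine (Finset.sum_le_sum fun j _ => h1 j).trans ?_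
  rw [← Finset.mul_sum]
  exact mul_le_mul_of_nonneg_left hy (Nat.cast_nonneg _)

/-- Joint measurability is needed for Fubini. The matrix inverse is a measurable scalar inverse
times the adjugate, including where the determinant vanishes. -/
theorem measurable_sum_nrm_leastSquares :
    Measurable fun z : (Fin N × Fin b → ℝ) × (Fin N × Fin p → ℝ) =>
      ∑ j, nrm ((Matrix.of fun i k => z.1 (i, k)) *ᵥ
        leastSquares (Matrix.of fun i k => z.1 (i, k)) fun i => z.2 (i, j)) ^ 2 := by
  have hcont : Continuous fun z : (Fin N × Fin b → ℝ) × (Fin N × Fin p → ℝ) =>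
      (Matrix.of fun (i : Fin N) (k : Fin b) => z.1 (i, k)) := by
    refine continuous_matrix fun i k => ?_
    simp only [Matrix.of_apply]
    fun_prop
  have hgram := hcont.matrix_transpose.matrix_mul hcont
  have hinv : ∀ k l, Measurable fun z : (Fin N × Fin b → ℝ) × (Fin N × Fin p → ℝ) =>
      ((Matrix.of fun (i : Fin N) (k : Fin b) => z.1 (i, k))ᵀ *
        Matrix.of fun (i : Fin N) (k : Fin b) => z.1 (i, k))⁻¹ k l := by
    intro k l
    simp only [Matrix.inv_def, Matrix.smul_apply, Ring.inverse_eq_inv', smul_eq_mul]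
    exact hgram.matrix_det.measurable.inv.mul (hgram.matrix_adjugate.matrix_elem k l).measurable
  have hentry : ∀ (i : Fin N) (k : Fin b), Measurable
      fun z : (Fin N × Fin b → ℝ) × (Fin N × Fin p → ℝ) =>
        (Matrix.of fun (i : Fin N) (k : Fin b) => z.1 (i, k)) i k :=
    fun i k => (hcont.matrix_elem i k).measurable
  simp only [nrm_sq_eq_sum, leastSquares, Matrix.mulVec, dotProduct]
  refine Finset.measurable_fun_sum _ fun j _ => Finset.measurable_fun_sum _ fun i _ => ?_
  refine Measurable.pow_const (Finset.measurable_fun_sum _ fun k _ => (hentry i k).mul ?_) 2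
  refine Finset.measurable_fun_sum _ fun l _ => (hinv k l).mul ?_
  exact Finset.measurable_fun_sum _ fun i _ => (hentry i l).mul (by fun_prop)

variable {Ω : Type*} [MeasurableSpace Ω] {μ : Measure Ω} [IsProbabilityMeasure μ]
  {D : Ω → Matrix (Fin N) (Fin b) ℝ} {η : Fin N → Fin p → Ω → ℝ}

/-- Arms and noise are independent, so their joint law is a product; the fixed-design bound holds on
every slice and integrates to itself. -/
theorem IsExploration.measure_noise_le (h : IsExploration μ D η) {t : ℝ} (ht : 0 ≤ t) :
    MeasurableSet {ω | 8 / 5 * (b * p) + 16 / 5 * t <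
        ∑ j, nrm (D ω *ᵥ leastSquares (D ω) fun i => η i j ω) ^ 2} ∧
      μ {ω | 8 / 5 * (b * p) + 16 / 5 * t <
        ∑ j, nrm (D ω *ᵥ leastSquares (D ω) fun i => η i j ω) ^ 2} ≤
      ENNReal.ofReal (Real.exp (-t)) := by
  set y : ℝ := 8 / 5 * (b * p) + 16 / 5 * t with hy
  set S : Set ((Fin N × Fin b → ℝ) × (Fin N × Fin p → ℝ)) :=
    {z | y < ∑ j, nrm ((Matrix.of fun i k => z.1 (i, k)) *ᵥ
        leastSquares (Matrix.of fun i k => z.1 (i, k)) fun i => z.2 (i, j)) ^ 2} with hS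
  have hSm : MeasurableSet S := measurableSet_lt measurable_const measurable_sum_nrm_leastSquares
  have hDm : Measurable fun ω (q : Fin N × Fin b) => D ω q.1 q.2 :=
    measurable_pi_lambda _ fun q => h.arm_measurable q.1 q.2
  have hηm : Measurable fun ω (q : Fin N × Fin p) => η q.1 q.2 ω :=
    measurable_pi_lambda _ fun q => h.noise_measurable q.1 q.2
  have hpre : {ω | y < ∑ j, nrm (D ω *ᵥ leastSquares (D ω) fun i => η i j ω) ^ 2} =
      (fun ω => ((fun q : Fin N × Fin b => D ω q.1 q.2),
        (fun q : Fin N × Fin p => η q.1 q.2 ω))) ⁻¹' S := rfl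
  rw [hpre]
  refine ⟨(hDm.prodMk hηm) hSm, ?_⟩
  rw [← Measure.map_apply (hDm.prodMk hηm) hSm,
    (indepFun_iff_map_prod_eq_prod_map_map hDm.aemeasurable hηm.aemeasurable).1 h.oblivious]
  have := Measure.isProbabilityMeasure_map (μ := μ) hDm.aemeasurable
  have := Measure.isProbabilityMeasure_map (μ := μ) hηm.aemeasurable
  rw [Measure.prod_apply hSm]
  refine (lintegral_mono (g := fun _ => ENNReal.ofReal (Real.exp (-t))) fun x => ?_).trans_eq
    (by simp)
  rw [Measure.map_apply hηm (measurable_prodMk_left hSm)]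
  exact RecTransfer.measure_noise_le h.noise_indep h.noise_measurable h.noise_subgaussian
    (Matrix.of fun i k => x (i, k)) ht

end Combination

end RecTransfer

end

/-! ### The main theorem -/

theorem mainTheorem2 :
    ∃ C : ℝ, 0 < C ∧
      ∀ (n a b r U U₀ H₀ N : ℕ) (_ha : 0 < a) (_hb : 0 < b) (hU : U₀ ≤ U) (_hH : H₀ = N * U₀)
        (A : Matrix (Fin a) (Fin n) ℝ) (B : Matrix (Fin b) (Fin n) ℝ)
        (_hA : A.rank = a) (_hB : B.rank = b) (θ : Fin U → Fin n → ℝ)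
        (𝒰 : Matrix (Fin a ⊕ Fin b) (Fin r) ℝ) (s : Fin r → ℝ) (𝒱 : Matrix (Fin n) (Fin r) ℝ)
        (_hSVD : RecTransfer.IsCompactSVD (Matrix.fromRows A B) 𝒰 s 𝒱)
        (Ω : Type*) (_mΩ : MeasurableSpace Ω) (μ : Measure Ω) (_hμ : IsProbabilityMeasure μ)
        (D : Ω → Matrix (Fin N) (Fin b) ℝ) (η : Fin N → Fin U₀ → Ω → ℝ)
        (_hexp : RecTransfer.IsExploration μ D η)
        (δ : ℝ) (_hδ0 : 0 < δ) (_hδ1 : δ < 1)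
        (θ₀ : Fin U₀ → Fin n → ℝ) (_hθ₀ : θ₀ = fun j => θ (Fin.castLE hU j))
        (M : Matrix (Fin a ⊕ Fin b) (Fin U₀) ℝ)
        (_hM : M = RecTransfer.stacked A θ₀ (fun j => B *ᵥ θ₀ j))
        (q Z : ℝ) (_hq : q = RecTransfer.noiseLevel C b U₀ H₀ δ)
        (_hZ : Z = q / (RecTransfer.sigma M r - q))
        (_hden : 0 < RecTransfer.noiseDenom C b U₀ H₀ δ)
        (_hMq : q < RecTransfer.sigma M r)
        (_hAZ : √2 * Z < RecTransfer.sigma 𝒰.toRows₁ a),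
        ∃ G : Set Ω, MeasurableSet G ∧ ENNReal.ofReal (1 - δ) ≤ μ G ∧
          ∀ ω ∈ G, ∀ (𝒰hat : Matrix (Fin a ⊕ Fin b) (Fin r) ℝ) (pinv : Matrix (Fin r) (Fin a) ℝ),
            RecTransfer.IsTopLeftSingular (RecTransfer.estimated A B θ₀ D η ω) 𝒰hat →
            RecTransfer.IsMoorePenrose 𝒰hat.toRows₁ pinv →
            ∀ (u : Fin U) (d : ℕ) (W : Matrix (Fin b) (Fin b) ℝ),
              RecTransfer.IsAdaptedBasis
                (RecTransfer.learnedSubspace 𝒰hat pinv (A *ᵥ θ u)) d W →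
              RecTransfer.tailMass d W (B *ᵥ θ u) ≤
                √2 * (1 + (RecTransfer.sigma 𝒰.toRows₁ a - √2 * Z)⁻¹) * Z *
                  RecTransfer.l2norm (Matrix.diagonal s *ᵥ (𝒱ᵀ *ᵥ θ u)) := by
  refine ⟨16, by norm_num, ?_⟩
  intro n a b r U U₀ H₀ N ha hb hU hH A B hA hB θ 𝒰 s 𝒱 hSVD Ω mΩ μ hμ D η hexp δ hδ0 hδ1 θ₀ hθ₀ M hM
    q Z hq hZ hden hMq hAZ
  -- For `U₀ = 0` the quotient `H₀ / U₀` is zero by convention, and the denominator of `q` would be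
  -- negative.
  have hU₀ : U₀ ≠ 0 := by
    rintro rfl
    have h1 : 0 < √(b : ℝ) := Real.sqrt_pos.2 (Nat.cast_pos.2 hb)
    have h2 := Real.sqrt_nonneg (Real.log (4 / δ))
    simp only [RecTransfer.noiseDenom, CharP.cast_eq_zero, div_zero, Real.sqrt_zero] at hden
    linarith
  have hU₀' : (0 : ℝ) < U₀ := Nat.cast_pos.2 (Nat.pos_of_ne_zero hU₀)
  have hb' : (0 : ℝ) < b := Nat.cast_pos.2 hb
  have hN : (H₀ : ℝ) / U₀ = N := by
    rw [hH]; push_cast; field_simp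
  set c := RecTransfer.noiseDenom 16 b U₀ H₀ δ with hc
  have hc' : c = √N - 16 * (√(b : ℝ) + √(Real.log (4 / δ))) := by
    rw [hc, RecTransfer.noiseDenom, hN]
  set t := Real.log (2 / δ) with ht
  have ht0 : 0 < t := Real.log_pos (by rw [lt_div_iff₀ hδ0]; linarith)
  have hq2 : q ^ 2 = b * U₀ * (b + t) / c ^ 2 := by
    rw [hq, RecTransfer.noiseLevel, div_pow, Real.sq_sqrt (by positivity)]
  have hq0 : 0 < q := by
    rw [hq, RecTransfer.noiseLevel]
    exact div_pos (Real.sqrt_pos.2 (by positivity)) hden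
  obtain ⟨S₁, hS₁m, hS₁, hS₁b⟩ := RecTransfer.exists_measure_arms_le hb hexp.arm_measurable
    hexp.arm_law hexp.arm_indep hδ0 hδ1 (hc' ▸ hden)
  rw [← hc'] at hS₁b
  obtain ⟨hS₂m, hS₂⟩ := hexp.measure_noise_le ht0.le
  set S₂ : Set Ω := {ω | 8 / 5 * (b * U₀) + 16 / 5 * t <
    ∑ j, RecTransfer.nrm (D ω *ᵥ RecTransfer.leastSquares (D ω) fun i => η i j ω) ^ 2} with hS₂d
  have hexpt : Real.exp (-t) = δ / 2 := by
    rw [Real.exp_neg, ht, Real.exp_log (by positivity), inv_div]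
  rw [hexpt] at hS₂
  refine ⟨(S₁ ∪ S₂)ᶜ, (hS₁m.union hS₂m).compl, ?_, ?_⟩
  · rw [prob_compl_eq_one_sub (hS₁m.union hS₂m), ENNReal.ofReal_sub _ hδ0.le, ENNReal.ofReal_one]
    refine tsub_le_tsub_left ?_ 1
    refine (measure_union_le _ _).trans ((add_le_add hS₁ hS₂).trans_eq ?_)
    rw [← ENNReal.ofReal_add (by positivity) (by positivity), add_halves]
  · intro ω hω V P hV hP u d W hW
    rw [Set.mem_compl_iff, Set.mem_union, not_or] at hω
    have hbound := RecTransfer.sum_error_le hden (hS₁b ω hω.1) (fun j => B *ᵥ θ₀ j)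
      (fun i j => η i j ω) (not_lt.1 hω.2)
    subst hM
    have key := RecTransfer.tailMass_le_of_sum_error_le hSVD ha hb hB θ₀ _ hq0 ?_ ?_ hMq hZ hAZ
      hV hP (θ u) hW
    · rw [RecTransfer.l2norm_eq_nrm]
      refine key.trans_eq ?_
      ring
    · intro hone
      refine hbound.trans ?_
      rw [hq2, mul_div_assoc', hone]
      refine div_le_div_of_nonneg_right ?_ (sq_nonneg c)
      push_cast
      nlinarith
    · intro hmany
      have h2 : (2 : ℝ) ≤ U₀ := by exact_mod_cast (by omega : 2 ≤ U₀)
      refine hbound.trans ?_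
      rw [hq2, mul_div_assoc']
      refine div_le_div_of_nonneg_right ?_ (sq_nonneg c)
      -- With at least two users `16/5 t ≤ 8/5 U₀ t`, so the numerator is at most `8/5 b U₀ (b +
      -- t)`.
      have h3 : 0 ≤ b * (t * (U₀ - 2)) := mul_nonneg hb'.le (mul_nonneg ht0.le (by linarith))
      nlinarith
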